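/- \textbf{Theorem (Gaussian VAE identifiability).} Let $\mathcal Z=\mathbb R^n$, $\mathcal X=\mathbb R^m$, and let $p(z)=\prod_{i=1}^n p_i(z_i)$ be a factorised prior on $\mathcal Z$, where each $p_i$ is a continuous, everywhere positive probability density on $\mathbb R$. Let $g:\mathcal Z\to\mathcal X$ (the data-generating function) and $d:\mathcal Z\to\mathcal X$ (the decoder of a Gaussian VAE with diagonal posteriors) be continuous and injective, homeomorphisms onto their images, and such that almost every $z$ is \emph{regular}, i.e. the map is $C^2$ near $z$ with Jacobian of full column rank at $z$. Write $J_z=U_zS_zV_z^\top$ for a thin SVD of the Jacobian. Assume that $g$ and $d$ both satisfy, for almost every $z$, (C1) $V_z=I$ for some SVD of $J_z$ (the $i$-th singular value $s^i(z)$ and left singular vector $u^i(z)$ are those of the latent axis $i$, i.e. the length and the direction of the $i$-th column of $J_z$); (C2) $\partial s^i/\partial z_j=0$ for all $i\neq j$. Assume that $\{g(z)\}=\{d(z)\}=:\mathcal M$ and that the manifold densities match, i.e. the push-forwards of the prior under $g$ and under $d$ are the same distribution on $\mathcal M$. Let $p_\mu(g(z))=p(z)\det(J_z^\top J_z)^{-1/2}$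 be the density of this distribution with respect to the volume of $\mathcal M$, and assume that for almost every $z$, at $x=g(z)$, the tangent Hessian of $\log p_\mu$ (the derivative along $\mathcal M$ of the on-manifold gradient of $\log p_\mu$, projected to the tangent space $T_x\mathcal M$) exists and has pairwise distinct eigenvalues. Let $\Omega_d$ be the set of regular points $z$ of $d$ such that $d(z)=g(z')$ for a regular point $z'$ of $g$, and define $\Omega_g$ in the same way with the roles of $g$ and $d$ exchanged. The $i$-th \emph{seam} of $d$ through $d(z)$ is the set of points reached from $d(z)$ in $d(\Omega_d)$ along curves $x_t$ with $\dot x_t=s^i u^i$, evaluated at $d^{-1}(x_t)$, and $p_i(z_i)/s^i(z)$ is the one-dimensional density over it at $d(z)$; likewise for $g$, in $g(\Omega_g)$. Then the following hold. (1) Almost every point of $\mathcal Z$ lies in $\Omega_d$, and almost every point lies in $\Omega_g$. (2) For every connected set $C\subseteq\Omega_d$ (e.g. a connected component) there are a permutation $\sigma$, signs $\varepsilon_i\in\{1,-1\}$ and constants $c_i>0$ with $\prod_i c_i=1$, such that for all $z\in C$, with $z'=g^{-1}(d(z))$, and for all $i$: C1 holds for $d$ at $z$ and for $g$ at $z'$,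 so that $J^{(d)}_z=U^{(d)}_zS^{(d)}_z$ and $J^{(g)}_{z'}=U^{(g)}_{z'}S^{(g)}_{z'}$ are SVDs, and $$p_\mu(d(z))=\prod_k\frac{p_k(z_k)}{s^k_d(z)}=\prod_k\frac{p_k(z'_k)}{s^k_g(z')},\qquad u^i_d(z)=\varepsilon_i\,u^{\sigma(i)}_g(z'),\qquad \frac{p_i(z_i)}{s^i_d(z)}=c_i\,\frac{p_{\sigma(i)}(z'_{\sigma(i)})}{s^{\sigma(i)}_g(z')},$$ and the $i$-th seam of $d$ through $d(z)$ is the $\sigma(i)$-th seam of $g$ through the same point. (3) If $\Omega_d$ is connected (e.g. if all points are regular for $g$ and for $d$), then (2) holds on $C=\Omega_d$ with one permutation $\sigma$, fixed signs $\varepsilon_i$ and all $c_i=1$: the seam decomposition of $p_\mu$ is recovered up to permutation and sign. Moreover, $g$ and $d$ have the same independent components: there are continuous, strictly monotone bijections $\tau_i:\mathbb R\to\mathbb R$ (increasing if $\varepsilon_i=1$, decreasing if $\varepsilon_i=-1$) that push the density $p_i$ forward to $p_{\sigma(i)}$, such that $z'_{\sigma(i)}=\tau_i(z_i)$ for all $i$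 whenever $g(z')=d(z)$. For every $i$ with $p_{\sigma(i)}(\varepsilon_i t)=p_i(t)$ for all $t$ (in particular for every $i$ if the $p_i$ are equal and even, such as for a standard Gaussian prior), one has $\tau_i(t)=\varepsilon_i t$ and $s^i_d(z)=s^{\sigma(i)}_g(z')$ for all $z\in\Omega_d$; hence the $U$ and $S$ factors of the Jacobians coincide, up to permutation and sign. -/

import Mathlib

namespace SeamId

noncomputable section

/-- Euclidean space `ℝⁿ` (latent space `𝒵 = ℝⁿ`, data space `𝒳 = ℝᵐ`). -/
abbrev E (n : ℕ) := EuclideanSpace ℝ (Fin n)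

/-- The one-dimensional priors: continuous, positive probability densities on `ℝ`
(positivity makes `log p_μ` meaningful on the whole manifold). -/
structure IsPriorDensity (q : ℝ → ℝ) : Prop where
  continuous : Continuous q
  pos : ∀ t, 0 < q t
  integral_eq_one : ∫ t, q t = 1

/-- The law on `ℝ` with density `q`. -/
def law1 (q : ℝ → ℝ) : MeasureTheory.Measure ℝ :=
  MeasureTheory.volume.withDensity fun t => ENNReal.ofReal (q t)

/-- The factorised prior `p(z) dz`, `p(z) = ∏ i, p_i(z_i)`, on latent space. -/
def latentLaw {n : ℕ} (p : Fin n → ℝ → ℝ) : MeasureTheory.Measure (E n) :=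
  MeasureTheory.volume.withDensity fun z => ENNReal.ofReal (∏ i, p i (z i))

/-- The regular set of `g`: near `z` the map is twice continuously differentiable, and the
Jacobian `J_z` has full column rank. -/
def regularSet {n m : ℕ} (g : E n → E m) : Set (E n) :=
  {z | ContDiffAt ℝ 2 g z ∧ Function.Injective (fderiv ℝ g z)}

/-- The generative functions: continuous and injective, with image `{g z}` embedded in data space
(`g` is a homeomorphism onto its image), and regular at almost every latent point. -/
structure IsGenerative {n m : ℕ} (g : E n → E m) : Prop where
  isEmbedding : Topology.IsEmbedding g
  ae_regular : ∀ᵐ z : E n, z ∈ regularSet g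

/-- `∂g/∂z_i` at `z`, the `i`-th column of the Jacobian. -/
def partialD {n m : ℕ} (g : E n → E m) (z : E n) (i : Fin n) : E m :=
  fderiv ℝ g z (EuclideanSpace.single i 1)

/-- The Jacobian matrix `[J_z]_{ki} = ∂x_k/∂z_i`. -/
def jacobian {n m : ℕ} (g : E n → E m) (z : E n) : Matrix (Fin m) (Fin n) ℝ :=
  Matrix.of fun k i => partialD g z i k

/-- `J = U S Vᵀ` is a (thin) singular value decomposition, `S = diag s`. -/
structure IsSVD {n m : ℕ} (J U : Matrix (Fin m) (Fin n) ℝ) (s : Fin n → ℝ)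
    (V : Matrix (Fin n) (Fin n) ℝ) : Prop where
  left_orthonormal : U.transpose * U = 1
  right_orthogonal : V.transpose * V = 1
  nonneg : ∀ i, 0 ≤ s i
  eq_mul : J = U * Matrix.diagonal s * V.transpose

/-- C1 at `z`: the right singular vectors of `J_z` are the standard basis vectors. The `i`-th
singular value is labelled by the latent axis `i` it belongs to, so that `V = I`. -/
def C1 {n m : ℕ} (g : E n → E m) (z : E n) : Prop :=
  ∃ (U : Matrix (Fin m) (Fin n) ℝ) (s : Fin n → ℝ), IsSVD (jacobian g z) U s 1

/-- The singular value `s^i(z)` of the latent axis `i`: when `V = I`, i.e. `J_z = U S`, it is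
the length of the `i`-th column of `J_z`. -/
def sv {n m : ℕ} (g : E n → E m) (z : E n) (i : Fin n) : ℝ := ‖partialD g z i‖

/-- The left singular vector `u^i(z)` of the latent axis `i`: when `V = I`, it is the
normalised `i`-th column of `J_z`. -/
def leftVec {n m : ℕ} (g : E n → E m) (z : E n) (i : Fin n) : E m :=
  (sv g z i)⁻¹ • partialD g z i

/-- The matrix `U_z` with columns `u^i(z)`. -/
def leftMatrix {n m : ℕ} (g : E n → E m) (z : E n) : Matrix (Fin m) (Fin n) ℝ :=
  Matrix.of fun k i => leftVec g z i k

/-- C2 at `z`: `∂s^i/∂z_j = 0` for all `i ≠ j`. -/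
def C2 {n m : ℕ} (g : E n → E m) (z : E n) : Prop :=
  ∀ i j, i ≠ j →
    HasDerivAt (fun t : ℝ => sv g (z + t • EuclideanSpace.single j (1 : ℝ)) i) 0 0

/-- The manifold density `p_μ` of the push-forward of the prior under `g`, with respect to the
volume of the manifold: `p_μ(g(z)) = det(J_zᵀ J_z)^{-1/2} p(z)`. -/
def manifoldDensity {n m : ℕ} (p : Fin n → ℝ → ℝ) (g : E n → E m) (x : E m) : ℝ :=
  (∏ i, p i (Function.invFun g x i)) /
    √((jacobian g (Function.invFun g x)).transpose * jacobian g (Function.invFun g x)).det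

/-- The tangent space of the manifold `{g z}` at `x`: the column span of the Jacobian. -/
def tangentSpaceAt {n m : ℕ} (g : E n → E m) (x : E m) : Submodule ℝ (E m) :=
  LinearMap.range (fderiv ℝ g (Function.invFun g x)).toLinearMap

/-- `v` is the on-manifold gradient at `x` of `f`, as a function on the manifold `{g z}`: it is
tangent, and `f y = f x + ⟪v, y - x⟫ + o(‖y - x‖)` along the manifold. -/
def IsTangentGradient {n m : ℕ} (g : E n → E m) (f : E m → ℝ) (x v : E m) : Prop :=
  v ∈ tangentSpaceAt g x ∧ HasFDerivWithinAt f (innerSL ℝ v) (Set.range g) x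

/-- `H` is the tangent Hessian at `x` of `f`, as a function on the manifold `{g z}`: the
derivative along the manifold of the on-manifold gradient, projected to the tangent space. -/
def IsTangentHessian {n m : ℕ} (g : E n → E m) (f : E m → ℝ) (x : E m)
    (H : Module.End ℝ (tangentSpaceAt g x)) : Prop :=
  ∃ (V : E m → E m) (A : E m →L[ℝ] E m),
    (∀ᶠ y in nhdsWithin x (Set.range g), IsTangentGradient g f y (V y)) ∧
    HasFDerivWithinAt V A (Set.range g) x ∧
    ∀ v : tangentSpaceAt g x, H v = (tangentSpaceAt g x).orthogonalProjectionOnto (A (v : E m))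

/-- The eigenvalues of `H` are pairwise distinct (for the symmetric operators considered here):
every eigenspace is at most one-dimensional. -/
def SimpleSpectrum {m : ℕ} {T : Submodule ℝ (E m)} (H : Module.End ℝ T) : Prop :=
  ∀ c : ℝ, Module.finrank ℝ (Module.End.eigenspace H c) ≤ 1

/-- The regular points of `g` whose images are also images of regular points of `h`. -/
def commonReg {n m : ℕ} (g h : E n → E m) : Set (E n) :=
  {z | z ∈ regularSet g ∧ g z ∈ h '' regularSet h}

/-- The `i`-th seam of `g` through `g z`, inside `g '' R`: all the points reached from `g z` along
curves `x` in `g '' R` with `x' = s^i u^i`, where `s^i u^i` is taken at `g⁻¹(x)`. -/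
def seam {n m : ℕ} (g : E n → E m) (R : Set (E n)) (i : Fin n) (z : E n) : Set (E m) :=
  {y | ∃ (x : ℝ → E m) (T : ℝ), x 0 = g z ∧ x T = y ∧ ∀ t ∈ Set.uIcc 0 T, x t ∈ g '' R ∧
    HasDerivWithinAt x
      (sv g (Function.invFun g (x t)) i • leftVec g (Function.invFun g (x t)) i)
      (Set.uIcc 0 T) t}

/-- The one-dimensional density `p_i(z_i) / s^i(z)` over the `i`-th seam at `g z`. -/
def seamDensity {n m : ℕ} (p : Fin n → ℝ → ℝ) (g : E n → E m) (z : E n) (i : Fin n) : ℝ :=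
  p i (z i) / sv g z i

/-- On the latent region `C`, the seam decomposition of the manifold density found by `d` is
that of `g`, up to the permutation `σ` and the signs `ε`; the seam densities agree up to the
normalising constants `c`. The points `z` and `z'` are the latent points of `d` and `g` over the
same point of the manifold. -/
structure IdentifiesOn {n m : ℕ} (p : Fin n → ℝ → ℝ) (g d : E n → E m) (C : Set (E n))
    (σ : Equiv.Perm (Fin n)) (ε c : Fin n → ℝ) : Prop where
  svd_d : ∀ z ∈ C, IsSVD (jacobian d z) (leftMatrix d z) (sv d z) 1
  svd_g : ∀ z ∈ C, ∀ z', g z' = d z → IsSVD (jacobian g z') (leftMatrix g z') (sv g z') 1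
  factor_d : ∀ z ∈ C, manifoldDensity p g (d z) = ∏ i, seamDensity p d z i
  factor_g : ∀ z ∈ C, ∀ z', g z' = d z →
    manifoldDensity p g (d z) = ∏ i, seamDensity p g z' i
  left_eq : ∀ z ∈ C, ∀ z', g z' = d z → ∀ i, leftVec d z i = ε i • leftVec g z' (σ i)
  seam_eq : ∀ z ∈ C, ∀ z', g z' = d z → ∀ i,
    seam d (commonReg d g) i z = seam g (commonReg g d) (σ i) z'
  density_eq : ∀ z ∈ C, ∀ z', g z' = d z → ∀ i,
    seamDensity p d z i = c i * seamDensity p g z' (σ i)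

end

end SeamId

/-!
# Identifiability of Gaussian VAEs through seams

The two maps `g` and `d` are global charts of one manifold, and everything is read off from the
transition map `h = g⁻¹ ∘ d`, a homeomorphism of latent space which preserves the prior
(`IsChartPair.map_transition`). Near a regular point an immersion has a `C²` left inverse, so `h` is
`C²` on the open conull set `commonReg d g`, and there the change of variables formula holds
pointwise (`IsChartPair.prior_eq`). The conditions C1 and C2 hold almost everywhere but are closed,
hence hold at every regular point: each chart has an orthogonal metric `∑ i, (s^i)² dz_i²` in which
`s^i` depends locally on `z_i` alone (`IsSeparable`).

In such a chart the mixed second derivatives `∂_i ∂_j g` are normal to the manifold, and the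
log-density is locally a sum of functions of one coordinate each. So the tangent Hessian of the
log-density is diagonal in the columns of the Jacobian, in the chart `g` and in the chart `d` alike
(`IsSeparable.hessian_apply_partialD`). Its spectrum being simple, the columns of the two
Jacobians are parallel up to a permutation: the Jacobian of `h` is a generalised permutation
matrix, almost everywhere and then everywhere by continuity
(`IsChartPair.transD_mul_transD_eq_zero`).

The pattern and the signs of the nonzero entries are locally constant. The quotient of the `i`-th
seam densities of `d` and `g` depends locally on `z_i` alone, and the product of these quotients
over `i` is one, so each is locally constant (`IsMonomialPair.eventually_ratio_eq`). This gives the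
permutation, the signs and the constants `c_i` on connected sets. A seam is the image of a segment
parallel to a latent axis (`mem_seam_iff`), and `h` carries such segments to such segments.

If the common regular set is connected, the density equation integrates to
`F_{σ i}(h(z)_{σ i}) = (ε_i / c_i) F_i(z_i) + κ_i`, with `F` the distribution functions of the
priors. This relation extends from the dense set `commonReg d g` to all of latent space
(`IsMonomialPair.exists_cdf_transition_eq`), although `h` itself need not be differentiable there.
Comparing the limits at infinity forces `c_i = 1` (`IsMonomialPair.const_eq_one`) and exhibits
`h(z)_{σ i}` as a function of `z_i`.
-/

namespace SeamId

open scoped Topology RealInnerProductSpace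
open Filter Set

/-! ### Latent axes -/

/-- The `i`-th standard basis vector of latent space, the direction of the `i`-th latent axis. -/
noncomputable abbrev axis {n : ℕ} (i : Fin n) : E n := EuclideanSpace.single i 1

theorem sum_smul_axis {n : ℕ} (v : E n) : ∑ i, v i • axis i = v := by
  ext k
  simp [axis, Finset.sum_apply, Pi.single_apply]

theorem map_eq_sum_axis {n : ℕ} {F : Type*} [NormedAddCommGroup F] [NormedSpace ℝ F]
    (A : E n →L[ℝ] F) (v : E n) : A v = ∑ i, v i • A (axis i) := by
  conv_lhs => rw [← sum_smul_axis v]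
  simp

theorem ext_axis {n : ℕ} {F : Type*} [NormedAddCommGroup F] [NormedSpace ℝ F]
    {A B : E n →L[ℝ] F} (h : ∀ i, A (axis i) = B (axis i)) : A = B := by
  ext1 v
  rw [map_eq_sum_axis A, map_eq_sum_axis B]
  simp [h]

/-! ### Regular points -/

/-- Compose with a linear left inverse of the derivative and apply the inverse function theorem. -/
theorem exists_leftInverse_of_mem_regularSet {n m : ℕ} {g : E n → E m} {z : E n}
    (hz : z ∈ regularSet g) :
    ∃ L : E m → E n, ContDiffAt ℝ 2 L (g z) ∧ ∀ᶠ w in 𝓝 z, L (g w) = w := by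
  obtain ⟨hc, hi⟩ := hz
  obtain ⟨P, hP⟩ := LinearMap.exists_leftInverse_of_injective (fderiv ℝ g z).toLinearMap
    (LinearMap.ker_eq_bot.2 hi)
  let P' : E m →L[ℝ] E n := LinearMap.toContinuousLinearMap P
  have hcomp : ContDiffAt ℝ 2 (fun w => P' (g w)) z := P'.contDiff.contDiffAt.comp z hc
  have hd : HasFDerivAt (fun w => P' (g w))
      ((ContinuousLinearEquiv.refl ℝ (E n) : E n ≃L[ℝ] E n) : E n →L[ℝ] E n) z := by
    have := P'.hasFDerivAt.comp z (hc.differentiableAt (by norm_num)).hasFDerivAt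
    refine this.congr_fderiv ?_
    ext1 v
    exact LinearMap.congr_fun hP v
  refine ⟨hcomp.localInverse hd (by norm_num) ∘ P', ?_, ?_⟩
  · exact (hcomp.to_localInverse hd (by norm_num)).comp (g z) P'.contDiff.contDiffAt
  · exact (hcomp.hasStrictFDerivAt' hd (by norm_num)).eventually_left_inverse

theorem isOpen_regularSet {n m : ℕ} (g : E n → E m) : IsOpen (regularSet g) := by
  refine isOpen_iff_mem_nhds.2 fun z hz => ?_
  obtain ⟨L, hL, hLg⟩ := exists_leftInverse_of_mem_regularSet hz
  have h1 := hL.eventually (by simp)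
  have h2 := hz.1.eventually (by simp)
  filter_upwards [hz.1.continuousAt.eventually h1, h2, hLg.eventually_nhds] with w hw1 hw2 hw3
  refine ⟨hw2, ?_⟩
  have hcomp := (hw1.differentiableAt (by norm_num)).hasFDerivAt.comp w
    (hw2.differentiableAt (by norm_num)).hasFDerivAt
  have hid : HasFDerivAt (L ∘ g) (ContinuousLinearMap.id ℝ (E n)) w :=
    (hasFDerivAt_id w).congr_of_eventuallyEq hw3
  have heq := hcomp.unique hid
  intro u v huv
  have := congrArg (fun A : E n →L[ℝ] E n => A u) heq
  have h' := congrArg (fun A : E n →L[ℝ] E n => A v) heq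
  simp only [ContinuousLinearMap.comp_apply, ContinuousLinearMap.id_apply] at this h'
  rw [← this, ← h', huv]

section Regular

variable {n m : ℕ} {g : E n → E m} {z : E n}

theorem hasFDerivAt_of_mem (hz : z ∈ regularSet g) : HasFDerivAt g (fderiv ℝ g z) z :=
  (hz.1.differentiableAt (by norm_num)).hasFDerivAt

theorem contDiffAt_fderiv (hz : z ∈ regularSet g) : ContDiffAt ℝ 1 (fderiv ℝ g) z :=
  hz.1.fderiv_right (by norm_num)

theorem contDiffAt_partialD (hz : z ∈ regularSet g) (i : Fin n) :
    ContDiffAt ℝ 1 (fun w => partialD g w i) z :=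
  (contDiffAt_fderiv hz).clm_apply contDiffAt_const

theorem continuousOn_partialD (i : Fin n) :
    ContinuousOn (fun w => partialD g w i) (regularSet g) := fun _ hz =>
  (contDiffAt_partialD hz i).continuousAt.continuousWithinAt

/-- The second partial derivative `∂²g/∂z_i∂z_j`. -/
noncomputable def partialD2 (g : E n → E m) (z : E n) (i j : Fin n) : E m :=
  fderiv ℝ (fderiv ℝ g) z (axis i) (axis j)

theorem partialD2_symm (hz : z ∈ regularSet g) (i j : Fin n) :
    partialD2 g z i j = partialD2 g z j i :=
  hz.1.isSymmSndFDerivAt (by simp) _ _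

theorem hasFDerivAt_partialD (hz : z ∈ regularSet g) (j : Fin n) :
    HasFDerivAt (fun w => partialD g w j) ((fderiv ℝ (fderiv ℝ g) z).flip (axis j)) z := by
  have h1 := ((contDiffAt_fderiv hz).differentiableAt (by norm_num)).hasFDerivAt
  have := h1.clm_apply (hasFDerivAt_const (axis j) z)
  refine this.congr_fderiv ?_
  ext1 v
  simp

theorem continuousOn_partialD2 (i j : Fin n) :
    ContinuousOn (fun w => partialD2 g w i j) (regularSet g) := fun z hz => by
  have h1 : ContDiffAt ℝ 0 (fderiv ℝ (fderiv ℝ g)) z :=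
    (contDiffAt_fderiv hz).fderiv_right (by norm_num)
  have h2 := (h1.clm_apply (contDiffAt_const (c := axis i))).clm_apply
    (contDiffAt_const (c := axis j))
  exact h2.continuousAt.continuousWithinAt

theorem hasDerivAt_line (i : Fin n) (z : E n) (t : ℝ) :
    HasDerivAt (fun s : ℝ => z + s • (axis i : E n)) (axis i) t := by
  simpa using ((hasDerivAt_id t).smul_const (axis i : E n)).const_add z

theorem partialD_ne_zero (hz : z ∈ regularSet g) (i : Fin n) : partialD g z i ≠ 0 := by
  intro h
  have : (axis i : E n) = 0 := hz.2 (by simpa [partialD] using h)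
  have := congrArg (fun v : E n => v i) this
  simp at this

theorem sv_pos (hz : z ∈ regularSet g) (i : Fin n) : 0 < sv g z i :=
  norm_pos_iff.2 (partialD_ne_zero hz i)

theorem sv_smul_leftVec (g : E n → E m) (z : E n) (i : Fin n) :
    sv g z i • leftVec g z i = partialD g z i := by
  by_cases h : partialD g z i = 0
  · simp [leftVec, sv, h]
  · exact smul_inv_smul₀ (norm_ne_zero_iff.2 h) _

/-! ### The two conditions on the whole regular set -/

theorem inner_partialD_eq_zero_of_C1 (h : C1 g z) {i j : Fin n} (hij : i ≠ j) :
    ⟪partialD g z i, partialD g z j⟫ = 0 := by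
  obtain ⟨U, s, hU⟩ := h
  have hJ := hU.eq_mul
  rw [Matrix.transpose_one, Matrix.mul_one] at hJ
  have key : ((jacobian g z).transpose * jacobian g z) i j = 0 := by
    rw [hJ, Matrix.transpose_mul, Matrix.diagonal_transpose, Matrix.mul_assoc,
      ← Matrix.mul_assoc U.transpose, hU.left_orthonormal, Matrix.one_mul,
      Matrix.diagonal_mul_diagonal, Matrix.diagonal_apply_ne _ hij]
  rw [Matrix.mul_apply] at key
  rw [PiLp.inner_apply]
  simpa [jacobian, mul_comm] using key

theorem inner_partialD2_eq_zero_of_C2 (hz : z ∈ regularSet g) (h : C2 g z) {i j : Fin n}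
    (hij : i ≠ j) : ⟪partialD2 g z j i, partialD g z i⟫ = 0 := by
  have h1 := (h i j hij).pow 2
  have h0 : z = z + (0 : ℝ) • (axis j : E n) := by simp
  have h2 : HasDerivAt (fun t : ℝ => partialD g (z + t • (axis j : E n)) i)
      (partialD2 g z j i) 0 := by
    exact (hasFDerivAt_partialD hz i).comp_hasDerivAt_of_eq (0 : ℝ) (hasDerivAt_line j z 0) h0
  have h3 := h2.norm_sq
  have := h3.unique (by simpa [sv, Pi.pow_def] using h1)
  simp only [zero_smul, add_zero] at this
  rw [real_inner_comm]
  linarith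

/-- A continuous function on an open set that vanishes almost everywhere vanishes throughout. -/
theorem eq_zero_of_ae_of_continuousOn {R : Set (E n)} (hR : IsOpen R) {f : E n → ℝ}
    (hf : ContinuousOn f R) (h : ∀ᵐ z, z ∈ R → f z = 0) : ∀ z ∈ R, f z = 0 := by
  have := MeasureTheory.Measure.eqOn_open_of_ae_eq (μ := MeasureTheory.volume) (f := f)
    (g := fun _ => 0) (U := R)
    ((MeasureTheory.ae_restrict_iff' hR.measurableSet).2 h) hR hf continuousOn_const
  exact this

end Regular

/-- The pointwise content of C1 and C2 on the regular set: the Jacobian columns are orthogonal,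
and `∂s^i/∂z_j = 0` for `i ≠ j`, written through `∂(s^i)²/∂z_j`. Unlike C1 and C2, these are
closed conditions, so they pass from almost every regular point to every one. -/
structure IsSeparable {n m : ℕ} (g : E n → E m) : Prop where
  inner_eq_zero : ∀ z ∈ regularSet g, ∀ i j, i ≠ j → ⟪partialD g z i, partialD g z j⟫ = 0
  inner2_eq_zero : ∀ z ∈ regularSet g, ∀ i j, i ≠ j → ⟪partialD2 g z j i, partialD g z i⟫ = 0

theorem isSeparable_of_ae {n m : ℕ} {g : E n → E m} (h : ∀ᵐ z, C1 g z ∧ C2 g z) :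
    IsSeparable g where
  inner_eq_zero z hz i j hij := by
    refine eq_zero_of_ae_of_continuousOn (isOpen_regularSet g)
      (f := fun z => ⟪partialD g z i, partialD g z j⟫)
      ((continuousOn_partialD i).inner (continuousOn_partialD j)) ?_ z hz
    filter_upwards [h] with w hw _ using inner_partialD_eq_zero_of_C1 hw.1 hij
  inner2_eq_zero z hz i j hij := by
    refine eq_zero_of_ae_of_continuousOn (isOpen_regularSet g)
      (f := fun z => ⟪partialD2 g z j i, partialD g z i⟫)
      ((continuousOn_partialD2 j i).inner (continuousOn_partialD i)) ?_ z hz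
    filter_upwards [h] with w hw hwr using inner_partialD2_eq_zero_of_C2 hwr hw.2 hij

namespace IsSeparable

variable {n m : ℕ} {g : E n → E m} {z : E n}

/-- The mixed second derivatives are normal to the manifold: all Christoffel symbols
`⟪∂_k g, ∂_i ∂_j g⟫` with `i ≠ j` of the diagonal metric `∑ (s^i)² dz_i²` vanish. -/
theorem inner_partialD_partialD2 (hg : IsSeparable g) (hz : z ∈ regularSet g) {i j : Fin n}
    (hij : i ≠ j) (k : Fin n) : ⟪partialD g z k, partialD2 g z i j⟫ = 0 := by
  have hanti : ∀ a b c : Fin n, b ≠ c →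
      ⟪partialD2 g z a b, partialD g z c⟫ = - ⟪partialD2 g z a c, partialD g z b⟫ := by
    intro a b c hbc
    have hd := (hasFDerivAt_partialD hz b).inner ℝ (hasFDerivAt_partialD hz c)
    have hev : (fun w => ⟪partialD g w b, partialD g w c⟫) =ᶠ[𝓝 z] fun _ => 0 := by
      filter_upwards [(isOpen_regularSet g).mem_nhds hz] with w hw
      exact hg.inner_eq_zero w hw b c hbc
    have h0 := hd.unique ((hasFDerivAt_const (0 : ℝ) z).congr_of_eventuallyEq hev)
    have := congrArg (fun A : E n →L[ℝ] ℝ => A (axis a)) h0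
    simp only [fderivInnerCLM_apply, ContinuousLinearMap.comp_apply,
      ContinuousLinearMap.prod_apply, ContinuousLinearMap.flip_apply,
      zero_apply] at this
    rw [real_inner_comm] at this
    simp only [partialD2]
    linarith
  rw [real_inner_comm]
  by_cases hjk : j = k
  · subst hjk
    exact hg.inner2_eq_zero z hz j i hij.symm
  by_cases hik : i = k
  · subst hik
    rw [partialD2_symm hz]
    exact hg.inner2_eq_zero z hz i j hij
  -- For distinct indices the symbol is symmetric in the first two and alternating in the last two.
  have h1 := hanti i j k hjk
  have h2 := hanti k i j hij
  have h3 := hanti j k i (Ne.symm hik)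
  rw [partialD2_symm hz i k] at h1
  rw [partialD2_symm hz k j] at h2
  rw [partialD2_symm hz j i] at h3
  linarith

end IsSeparable

/-! ### Coordinates separate locally -/

theorem eq_of_hasDerivWithinAt_zero {F : Type*} [NormedAddCommGroup F] [NormedSpace ℝ F]
    {f : ℝ → F} {s : Set ℝ} (hs : Convex ℝ s) (hf : ∀ t ∈ s, HasDerivWithinAt f 0 s t)
    {a b : ℝ} (ha : a ∈ s) (hb : b ∈ s) : f a = f b := by
  have := hs.norm_image_sub_le_of_norm_hasDerivWithin_le (C := 0) (f' := fun _ => 0) hf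
    (by simp) hb ha
  simpa [sub_eq_zero] using this

/-- Balls are convex, and along the segment from `w` to `w'` only coordinates other than `i` vary. -/
theorem eq_of_coord_eq {n : ℕ} {f : E n → ℝ} {z : E n} {δ : ℝ} {i : Fin n}
    (hf : ∀ w ∈ Metric.ball z δ, DifferentiableAt ℝ f w)
    (hf' : ∀ w ∈ Metric.ball z δ, ∀ j, j ≠ i → fderiv ℝ f w (axis j) = 0)
    {w w' : E n} (hw : w ∈ Metric.ball z δ) (hw' : w' ∈ Metric.ball z δ) (h : w i = w' i) :
    f w = f w' := by
  have hline : ∀ t : ℝ, HasDerivAt (fun s : ℝ => w + s • (w' - w)) (w' - w) t := fun t => by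
    simpa using ((hasDerivAt_id t).smul_const (w' - w)).const_add w
  have hmem : ∀ t ∈ Icc (0 : ℝ) 1, w + t • (w' - w) ∈ Metric.ball z δ := fun t ht =>
    (convex_ball z δ).add_smul_sub_mem hw hw' ht
  have key := eq_of_hasDerivWithinAt_zero (f := fun t : ℝ => f (w + t • (w' - w)))
    (convex_Icc (0 : ℝ) 1) (fun t ht => ?_) (a := 0) (b := 1) (by simp) (by simp)
  · simpa using key
  · have h1 := (hf _ (hmem t ht)).hasFDerivAt.comp_hasDerivAt t (hline t)
    have h0 : fderiv ℝ f (w + t • (w' - w)) (w' - w) = 0 := by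
      rw [map_eq_sum_axis]
      refine Finset.sum_eq_zero fun j _ => ?_
      by_cases hj : j = i
      · simp [hj, h]
      · rw [hf' _ (hmem t ht) j hj, smul_zero]
    rw [h0] at h1
    exact h1.hasDerivWithinAt

namespace IsSeparable

variable {n m : ℕ} {g : E n → E m} {z : E n}

theorem exists_ball_sv_eq (hg : IsSeparable g) (hz : z ∈ regularSet g) :
    ∃ δ > 0, Metric.ball z δ ⊆ regularSet g ∧
      ∀ w ∈ Metric.ball z δ, ∀ w' ∈ Metric.ball z δ, ∀ i, w i = w' i → sv g w i = sv g w' i := by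
  obtain ⟨δ, hδ, hsub⟩ := Metric.isOpen_iff.1 (isOpen_regularSet g) z hz
  refine ⟨δ, hδ, hsub, fun w hw w' hw' i h => ?_⟩
  have hd : ∀ w ∈ Metric.ball z δ, HasFDerivAt (fun w => ‖partialD g w i‖ ^ 2) _ w :=
    fun w hw => (hasFDerivAt_partialD (hsub hw) i).norm_sq
  have key := eq_of_coord_eq (f := fun w => ‖partialD g w i‖ ^ 2) (i := i)
    (fun w hw => (hd w hw).differentiableAt) (fun w hw j hj => ?_) hw hw' h
  · exact (sq_eq_sq₀ (norm_nonneg _) (norm_nonneg _)).1 key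
  · rw [(hd w hw).fderiv]
    have := hg.inner2_eq_zero w (hsub hw) i j hj.symm
    rw [real_inner_comm] at this
    simp only [partialD2] at this
    simp [this]

theorem transpose_mul_jacobian (hg : IsSeparable g) (hz : z ∈ regularSet g) :
    (jacobian g z).transpose * jacobian g z = Matrix.diagonal fun i => sv g z i ^ 2 := by
  ext i j
  have : ((jacobian g z).transpose * jacobian g z) i j = ⟪partialD g z j, partialD g z i⟫ := by
    rw [Matrix.mul_apply, PiLp.inner_apply]
    simp [jacobian]
  rw [this]
  by_cases hij : i = j
  · subst hij
    rw [Matrix.diagonal_apply_eq, real_inner_self_eq_norm_sq, sv]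
  · rw [Matrix.diagonal_apply_ne _ hij, hg.inner_eq_zero z hz j i (Ne.symm hij)]

theorem sqrt_det (hg : IsSeparable g) (hz : z ∈ regularSet g) :
    √((jacobian g z).transpose * jacobian g z).det = ∏ i, sv g z i := by
  rw [hg.transpose_mul_jacobian hz, Matrix.det_diagonal, Finset.prod_pow,
    Real.sqrt_sq (Finset.prod_nonneg fun i _ => (sv_pos hz i).le)]

theorem isSVD (hg : IsSeparable g) (hz : z ∈ regularSet g) :
    IsSVD (jacobian g z) (leftMatrix g z) (sv g z) 1 where
  left_orthonormal := by
    have hU : leftMatrix g z = jacobian g z * Matrix.diagonal fun i => (sv g z i)⁻¹ := by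
      ext k i
      simp [leftMatrix, leftVec, jacobian, Matrix.mul_diagonal, mul_comm]
    rw [hU, Matrix.transpose_mul, Matrix.diagonal_transpose, Matrix.mul_assoc,
      ← Matrix.mul_assoc (jacobian g z).transpose, hg.transpose_mul_jacobian hz,
      Matrix.diagonal_mul_diagonal, Matrix.diagonal_mul_diagonal, ← Matrix.diagonal_one]
    congr 1
    ext i
    have := (sv_pos hz i).ne'
    field_simp
  right_orthogonal := by simp
  nonneg i := norm_nonneg _
  eq_mul := by
    rw [Matrix.transpose_one, Matrix.mul_one]
    ext k i
    have := congrArg (fun v : E m => v k) (sv_smul_leftVec g z i)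
    simp only [PiLp.smul_apply, smul_eq_mul] at this
    simp [Matrix.mul_diagonal, leftMatrix, jacobian, ← this, mul_comm]

end IsSeparable

/-! ### Seams are the images of segments parallel to the latent axes -/

section Seam

variable {n m : ℕ} {g : E n → E m}

theorem invFun_apply (hg : IsGenerative g) (z : E n) : Function.invFun g (g z) = z :=
  Function.leftInverse_invFun hg.isEmbedding.injective z

/-- The flow along `s^i u^i = ∂_i g` is, in latent space, translation along the `i`-th axis. -/
theorem mem_seam_iff (hg : IsGenerative g) {R : Set (E n)} (hR : R ⊆ regularSet g) (i : Fin n)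
    (z : E n) (y : E m) :
    y ∈ seam g R i z ↔ ∃ T : ℝ, g (z + T • axis i) = y ∧
      ∀ t ∈ uIcc 0 T, z + t • axis i ∈ R := by
  constructor
  · rintro ⟨x, T, hx0, hxT, hx⟩
    -- The latent curve `g⁻¹ ∘ x` has constant velocity `axis i`.
    set ζ : ℝ → E n := fun t => Function.invFun g (x t) with hζ
    have hgζ : ∀ t ∈ uIcc 0 T, g (ζ t) = x t ∧ ζ t ∈ R := fun t ht => by
      obtain ⟨w, hw, hwx⟩ := (hx t ht).1
      simp only [hζ, ← hwx, invFun_apply hg]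
      exact ⟨trivial, hw⟩
    have hcont : ContinuousOn ζ (uIcc 0 T) := by
      rw [hg.isEmbedding.isInducing.continuousOn_iff]
      exact ContinuousOn.congr (fun t ht => (hx t ht).2.continuousWithinAt)
        fun t ht => (hgζ t ht).1
    have hder : ∀ t ∈ uIcc 0 T, HasDerivWithinAt ζ (axis i) (uIcc 0 T) t := fun t ht => by
      have hreg := hR (hgζ t ht).2
      obtain ⟨L, hL, hLg⟩ := exists_leftInverse_of_mem_regularSet hreg
      have hLd := (hL.differentiableAt (by norm_num)).hasFDerivAt
      have hLx : HasDerivWithinAt (fun s => L (x s))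
          (fderiv ℝ L (g (ζ t)) (partialD g (ζ t) i)) (uIcc 0 T) t := by
        have h2 := (hx t ht).2
        rw [sv_smul_leftVec] at h2
        exact hLd.comp_hasDerivWithinAt_of_eq t h2 (hgζ t ht).1
      have hid : fderiv ℝ L (g (ζ t)) (partialD g (ζ t) i) = axis i := by
        have h1 := (hLd.comp (ζ t) (hasFDerivAt_of_mem hreg)).unique
          ((hasFDerivAt_id (ζ t)).congr_of_eventuallyEq hLg)
        exact congrArg (fun A : E n →L[ℝ] E n => A (axis i)) h1
      rw [hid] at hLx
      refine hLx.congr_of_eventuallyEq_of_mem ?_ ht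
      filter_upwards [(hcont t ht).eventually hLg, self_mem_nhdsWithin] with s hs hsT
      rw [← (hgζ s hsT).1, hs]
    have hconst : ∀ t ∈ uIcc 0 T, ζ t = z + t • axis i := fun t ht => by
      have h0 : ζ 0 = z := by simp only [hζ, hx0, invFun_apply hg]
      have := eq_of_hasDerivWithinAt_zero (f := fun s => ζ s - s • (axis i : E n))
        (convex_uIcc 0 T) (fun s hs => by
          have h1 := ((hasDerivAt_id s).smul_const (axis i : E n)).hasDerivWithinAt (s := uIcc 0 T)
          have h2 := (hder s hs).fun_sub h1
          rwa [one_smul, sub_self] at h2) ht left_mem_uIcc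
      simp only [zero_smul, sub_zero, h0] at this
      rw [← this, sub_add_cancel]
    refine ⟨T, ?_, fun t ht => hconst t ht ▸ (hgζ t ht).2⟩
    rw [← hconst T right_mem_uIcc, (hgζ T right_mem_uIcc).1, hxT]
  · rintro ⟨T, hT, hz⟩
    refine ⟨fun t => g (z + t • axis i), T, by simp, hT, fun t ht => ⟨⟨_, hz t ht, rfl⟩, ?_⟩⟩
    rw [sv_smul_leftVec, invFun_apply hg]
    exact ((hasFDerivAt_of_mem (hR (hz t ht))).comp_hasDerivAt t
      (hasDerivAt_line i z t)).hasDerivWithinAt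

end Seam

/-! ### The transition map between two charts of the manifold -/

/-- Two generative functions with the same image: two global charts of one manifold. -/
structure IsChartPair {n m : ℕ} (g d : E n → E m) : Prop where
  left : IsGenerative g
  right : IsGenerative d
  range_eq : range d = range g

/-- The transition map `g⁻¹ ∘ d` on latent space. -/
noncomputable def transition {n m : ℕ} (g d : E n → E m) (z : E n) : E n :=
  Function.invFun g (d z)

/-- The entry `∂(g⁻¹ ∘ d)_k / ∂z_i` of the Jacobian of the transition map. -/
noncomputable def transD {n m : ℕ} (g d : E n → E m) (z : E n) (k i : Fin n) : ℝ :=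
  fderiv ℝ (transition g d) z (axis i) k

namespace IsChartPair

variable {n m : ℕ} {g d : E n → E m} {z : E n}

theorem symm (h : IsChartPair g d) : IsChartPair d g := ⟨h.right, h.left, h.range_eq.symm⟩

theorem apply_transition (h : IsChartPair g d) (z : E n) : g (transition g d z) = d z :=
  Function.invFun_eq (f := g) (h.range_eq ▸ mem_range_self z : d z ∈ range g)

theorem eq_transition (h : IsChartPair g d) {z z' : E n} (hz : g z' = d z) :
    z' = transition g d z :=
  h.left.isEmbedding.injective (hz.trans (h.apply_transition z).symm)

theorem transition_transition (h : IsChartPair g d) (z : E n) :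
    transition d g (transition g d z) = z := by
  rw [transition, h.apply_transition, invFun_apply h.right]

theorem continuous_transition (h : IsChartPair g d) : Continuous (transition g d) := by
  rw [h.left.isEmbedding.isInducing.continuous_iff]
  exact h.right.isEmbedding.continuous.congr fun z => (h.apply_transition z).symm

theorem mem_commonReg_iff (h : IsChartPair g d) :
    z ∈ commonReg d g ↔ z ∈ regularSet d ∧ transition g d z ∈ regularSet g := by
  refine and_congr_right fun _ => ⟨?_, fun hz => ⟨_, hz, h.apply_transition z⟩⟩
  rintro ⟨w, hw, hwz⟩
  rwa [← h.eq_transition hwz]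

theorem isOpen_commonReg (h : IsChartPair g d) : IsOpen (commonReg d g) := by
  have : commonReg d g = regularSet d ∩ transition g d ⁻¹' regularSet g :=
    Set.ext fun _ => h.mem_commonReg_iff
  rw [this]
  exact (isOpen_regularSet d).inter ((isOpen_regularSet g).preimage h.continuous_transition)

theorem transition_mem_commonReg (h : IsChartPair g d) (hz : z ∈ commonReg d g) :
    transition g d z ∈ commonReg g d := by
  rw [h.symm.mem_commonReg_iff, h.transition_transition]
  exact (h.mem_commonReg_iff.1 hz).symm

theorem contDiffAt_transition (h : IsChartPair g d) (hz : z ∈ commonReg d g) :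
    ContDiffAt ℝ 2 (transition g d) z := by
  obtain ⟨hzd, hzg⟩ := h.mem_commonReg_iff.1 hz
  obtain ⟨L, hL, hLg⟩ := exists_leftInverse_of_mem_regularSet hzg
  rw [h.apply_transition] at hL
  refine (hL.comp z hzd.1).congr_of_eventuallyEq ?_
  filter_upwards [h.continuous_transition.continuousAt.eventually hLg] with w hw
  rw [h.apply_transition] at hw
  exact hw.symm

theorem hasFDerivAt_transition (h : IsChartPair g d) (hz : z ∈ commonReg d g) :
    HasFDerivAt (transition g d) (fderiv ℝ (transition g d) z) z :=
  ((h.contDiffAt_transition hz).differentiableAt (by norm_num)).hasFDerivAt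

theorem fderiv_eq_comp (h : IsChartPair g d) (hz : z ∈ commonReg d g) :
    fderiv ℝ d z = (fderiv ℝ g (transition g d z)).comp (fderiv ℝ (transition g d) z) := by
  have h1 := (hasFDerivAt_of_mem (h.mem_commonReg_iff.1 hz).2).comp z (h.hasFDerivAt_transition hz)
  have h2 : g ∘ transition g d = d := funext h.apply_transition
  rw [h2] at h1
  exact h1.fderiv

theorem injective_fderiv_transition (h : IsChartPair g d) (hz : z ∈ commonReg d g) :
    Function.Injective (fderiv ℝ (transition g d) z) := by
  have := (h.mem_commonReg_iff.1 hz).1.2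
  rw [h.fderiv_eq_comp hz] at this
  exact Function.Injective.of_comp this

theorem range_fderiv_eq (h : IsChartPair g d) (hz : z ∈ commonReg d g) :
    LinearMap.range (fderiv ℝ d z).toLinearMap =
      LinearMap.range (fderiv ℝ g (transition g d z)).toLinearMap := by
  have hsurj : Function.Surjective (fderiv ℝ (transition g d) z).toLinearMap :=
    LinearMap.injective_iff_surjective.1 (h.injective_fderiv_transition hz)
  rw [h.fderiv_eq_comp hz, ContinuousLinearMap.toLinearMap_comp, LinearMap.range_comp,
    LinearMap.range_eq_top.2 hsurj, Submodule.map_top]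

theorem partialD_eq_sum (h : IsChartPair g d) (hz : z ∈ commonReg d g) (i : Fin n) :
    partialD d z i = ∑ k, transD g d z k i • partialD g (transition g d z) k := by
  rw [partialD, h.fderiv_eq_comp hz, ContinuousLinearMap.comp_apply, map_eq_sum_axis]
  rfl

theorem continuousOn_fderiv_transition (h : IsChartPair g d) :
    ContinuousOn (fderiv ℝ (transition g d)) (commonReg d g) := fun _ hz =>
  ((h.contDiffAt_transition hz).fderiv_right (m := 1) (by norm_num)).continuousAt.continuousWithinAt

theorem continuousOn_transD (h : IsChartPair g d) (k i : Fin n) :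
    ContinuousOn (fun z => transD g d z k i) (commonReg d g) :=
  (EuclideanSpace.proj (𝕜 := ℝ) k).continuous.comp_continuousOn
    (h.continuousOn_fderiv_transition.clm_apply continuousOn_const)

theorem hasFDerivAt_transition_apply (h : IsChartPair g d) (hz : z ∈ commonReg d g) (k : Fin n) :
    HasFDerivAt (fun w => transition g d w k)
      ((EuclideanSpace.proj (𝕜 := ℝ) k).comp (fderiv ℝ (transition g d) z)) z :=
  (EuclideanSpace.proj (𝕜 := ℝ) k).hasFDerivAt.comp z (h.hasFDerivAt_transition hz)

theorem fderiv_transition_apply (h : IsChartPair g d) (hz : z ∈ commonReg d g) (k i : Fin n) :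
    fderiv ℝ (fun w => transition g d w k) z (axis i) = transD g d z k i := by
  have := (h.hasFDerivAt_transition_apply hz k).fderiv
  rw [this]
  rfl

/-- The volume elements of the two charts differ by the Jacobian determinant of the transition. -/
theorem prod_sv_eq (h : IsChartPair g d) (hgS : IsSeparable g) (hdS : IsSeparable d)
    (hz : z ∈ commonReg d g) :
    ∏ i, sv d z i =
      (∏ i, sv g (transition g d z) i) * |(fderiv ℝ (transition g d) z).det| := by
  obtain ⟨hzd, hzg⟩ := h.mem_commonReg_iff.1 hz
  rw [← hdS.sqrt_det hzd, ← hgS.sqrt_det hzg]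
  set M : Matrix (Fin n) (Fin n) ℝ := Matrix.of fun k i => transD g d z k i with hMdef
  have hJ : jacobian d z = jacobian g (transition g d z) * M := by
    ext k i
    have := congrArg (fun v : E m => v k) (h.partialD_eq_sum hz i)
    simp only [WithLp.ofLp_sum, Finset.sum_apply, PiLp.smul_apply, smul_eq_mul] at this
    simp [Matrix.mul_apply, jacobian, this, hMdef, mul_comm]
  have hdet : (fderiv ℝ (transition g d) z).det = M.det := by
    rw [ContinuousLinearMap.det, ← LinearMap.det_toMatrix (EuclideanSpace.basisFun (Fin n) ℝ).toBasis]
    congr 1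
  set J := jacobian g (transition g d z)
  have hG : (J * M).transpose * (J * M) = M.transpose * (J.transpose * J) * M := by
    simp only [Matrix.transpose_mul, Matrix.mul_assoc]
  rw [hJ, hG, Matrix.det_mul, Matrix.det_mul, Matrix.det_transpose, hdet,
    mul_comm M.det, mul_assoc, ← pow_two, Real.sqrt_mul' _ (sq_nonneg _), Real.sqrt_sq_eq_abs]

end IsChartPair

/-! ### The transition map preserves the prior -/

section Prior

open MeasureTheory

variable {n m : ℕ} {p : Fin n → ℝ → ℝ} {g d : E n → E m}

theorem continuous_prior (hp : ∀ i, IsPriorDensity (p i)) :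
    Continuous fun z : E n => ∏ i, p i (z i) :=
  continuous_finsetProd _ fun i _ =>
    (hp i).continuous.comp (EuclideanSpace.proj (𝕜 := ℝ) i).continuous

theorem prior_pos (hp : ∀ i, IsPriorDensity (p i)) (z : E n) : 0 < ∏ i, p i (z i) :=
  Finset.prod_pos fun i _ => (hp i).pos _

theorem volume_absolutelyContinuous_latentLaw (hp : ∀ i, IsPriorDensity (p i)) :
    (volume : Measure (E n)) ≪ latentLaw p := by
  refine withDensity_absolutelyContinuous' ?_ ?_
  · exact (continuous_prior hp).measurable.ennreal_ofReal.aemeasurable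
  · exact ae_of_all _ fun z => (ENNReal.ofReal_pos.2 (prior_pos hp z)).ne'

theorem IsGenerative.measurableEmbedding (hg : IsGenerative g) : MeasurableEmbedding g :=
  hg.isEmbedding.continuous.measurableEmbedding hg.isEmbedding.injective

namespace IsChartPair

/-- As `g` is a measurable embedding, equality of the push-forwards can be pulled back by `g`. -/
theorem map_transition (h : IsChartPair g d)
    (hmatch : (latentLaw p).map d = (latentLaw p).map g) :
    (latentLaw p).map (transition g d) = latentLaw p := by
  have hd : d = g ∘ transition g d := funext fun z => (h.apply_transition z).symm
  have hgm := h.left.measurableEmbedding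
  rw [hd, ← Measure.map_map hgm.measurable h.continuous_transition.measurable] at hmatch
  have := congrArg (Measure.comap g) hmatch
  rwa [hgm.comap_map, hgm.comap_map] at this

theorem quasiMeasurePreserving_transition (h : IsChartPair g d)
    (hp : ∀ i, IsPriorDensity (p i)) (hmatch : (latentLaw p).map d = (latentLaw p).map g) :
    Measure.QuasiMeasurePreserving (transition g d) volume volume := by
  refine ⟨h.continuous_transition.measurable, ?_⟩
  have h1 := (volume_absolutelyContinuous_latentLaw hp).map h.continuous_transition.measurable
  rw [h.map_transition hmatch] at h1
  exact h1.trans (withDensity_absolutelyContinuous _ _)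

theorem ae_mem_commonReg (h : IsChartPair g d) (hp : ∀ i, IsPriorDensity (p i))
    (hmatch : (latentLaw p).map d = (latentLaw p).map g) :
    ∀ᵐ z : E n, z ∈ commonReg d g := by
  filter_upwards [h.right.ae_regular,
    (h.quasiMeasurePreserving_transition hp hmatch).ae h.left.ae_regular] with z h1 h2
  exact h.mem_commonReg_iff.2 ⟨h1, h2⟩

/-- Change of variables for the prior, first almost everywhere and then everywhere on the open
set by continuity. -/
theorem prior_eq (h : IsChartPair g d) (hp : ∀ i, IsPriorDensity (p i))
    (hmatch : (latentLaw p).map d = (latentLaw p).map g) {z : E n} (hz : z ∈ commonReg d g) :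
    ∏ i, p i (z i) =
      |(fderiv ℝ (transition g d) z).det| * ∏ i, p i (transition g d z i) := by
  set P : E n → ℝ := fun z => ∏ i, p i (z i) with hP
  set Ω := commonReg d g with hΩ
  have hΩo : IsOpen Ω := h.isOpen_commonReg
  have hPc : Continuous P := continuous_prior hp
  set Q : E n → ℝ := fun z => |(fderiv ℝ (transition g d) z).det| * P (transition g d z) with hQ
  have hQc : ContinuousOn Q Ω :=
    ((ContinuousLinearMap.continuous_det.comp_continuousOn h.continuousOn_fderiv_transition).abs).mul
      (hPc.comp h.continuous_transition).continuousOn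
  have hinj : Function.Injective (transition g d) :=
    Function.LeftInverse.injective h.transition_transition
  have hemb : MeasurableEmbedding (transition g d) :=
    h.continuous_transition.measurableEmbedding hinj
  have hset : ∀ A, MeasurableSet A → A ⊆ Ω →
      ∫⁻ z in A, ENNReal.ofReal (P z) = ∫⁻ z in A, ENNReal.ofReal (Q z) := by
    intro A hA hAΩ
    have h1 : latentLaw p (transition g d '' A) = latentLaw p A := by
      conv_lhs => rw [← h.map_transition hmatch]
      rw [hemb.map_apply, preimage_image_eq _ hinj]
    rw [latentLaw, withDensity_apply _ (hemb.measurableSet_image.2 hA), withDensity_apply _ hA,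
      lintegral_image_eq_lintegral_abs_det_fderiv_mul _ hA
        (fun z hz => (h.hasFDerivAt_transition (hAΩ hz)).hasFDerivWithinAt) hinj.injOn] at h1
    rw [← h1]
    refine lintegral_congr fun z => ?_
    rw [hQ, ENNReal.ofReal_mul (abs_nonneg _)]
  have hQm : AEMeasurable (fun z => ENNReal.ofReal (Q z)) (volume.restrict Ω) :=
    (hQc.aemeasurable hΩo.measurableSet).ennreal_ofReal
  have hPm : AEMeasurable (fun z => ENNReal.ofReal (P z)) (volume.restrict Ω) :=
    hPc.measurable.ennreal_ofReal.aemeasurable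
  have hae : (fun z => ENNReal.ofReal (P z)) =ᵐ[volume.restrict Ω]
      fun z => ENNReal.ofReal (Q z) := by
    refine (withDensity_eq_iff_of_sigmaFinite hPm hQm).1 (Measure.ext fun A hA => ?_)
    rw [withDensity_apply _ hA, withDensity_apply _ hA, Measure.restrict_restrict hA]
    exact hset _ (hA.inter hΩo.measurableSet) inter_subset_right
  have hae' : P =ᵐ[volume.restrict Ω] Q := by
    filter_upwards [hae] with z hz
    refine (ENNReal.ofReal_eq_ofReal_iff (prior_pos hp z).le ?_).1 hz
    exact mul_nonneg (abs_nonneg _) (prior_pos hp _).le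
  exact Measure.eqOn_open_of_ae_eq hae' hΩo hPc.continuousOn hQc hz

end IsChartPair

/-! ### The manifold density as a product of seam densities -/

theorem prod_seamDensity (p : Fin n → ℝ → ℝ) (g : E n → E m) (z : E n) :
    ∏ i, seamDensity p g z i = (∏ i, p i (z i)) / ∏ i, sv g z i :=
  Finset.prod_div_distrib _ _

theorem manifoldDensity_apply (hg : IsGenerative g) (hgS : IsSeparable g) {z : E n}
    (hz : z ∈ regularSet g) :
    manifoldDensity p g (g z) = ∏ i, seamDensity p g z i := by
  rw [manifoldDensity, invFun_apply hg, hgS.sqrt_det hz, prod_seamDensity]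

theorem IsChartPair.prod_seamDensity_transition (h : IsChartPair g d) (hgS : IsSeparable g)
    (hdS : IsSeparable d) (hp : ∀ i, IsPriorDensity (p i))
    (hmatch : (latentLaw p).map d = (latentLaw p).map g) {z : E n} (hz : z ∈ commonReg d g) :
    ∏ i, seamDensity p d z i = ∏ i, seamDensity p g (transition g d z) i := by
  obtain ⟨hzd, hzg⟩ := h.mem_commonReg_iff.1 hz
  have h1 : ∏ i, sv d z i ≠ 0 := Finset.prod_ne_zero_iff.2 fun i _ => (sv_pos hzd i).ne'
  have h2 : ∏ i, sv g (transition g d z) i ≠ 0 :=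
    Finset.prod_ne_zero_iff.2 fun i _ => (sv_pos hzg i).ne'
  rw [prod_seamDensity, prod_seamDensity, div_eq_div_iff h1 h2, h.prod_sv_eq hgS hdS hz,
    h.prior_eq hp hmatch hz]
  ring

theorem IsChartPair.manifoldDensity_apply_right (h : IsChartPair g d) (hgS : IsSeparable g)
    (hdS : IsSeparable d) (hp : ∀ i, IsPriorDensity (p i))
    (hmatch : (latentLaw p).map d = (latentLaw p).map g) {z : E n} (hz : z ∈ commonReg d g) :
    manifoldDensity p g (d z) = ∏ i, seamDensity p d z i := by
  rw [h.prod_seamDensity_transition hgS hdS hp hmatch hz, ← h.apply_transition,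
    manifoldDensity_apply h.left hgS (h.mem_commonReg_iff.1 hz).2]

end Prior

/-! ### The tangent Hessian is diagonal in the Jacobian columns -/

section Hessian

variable {n m : ℕ} {p : Fin n → ℝ → ℝ} {g k : E n → E m} {z : E n}

theorem seamDensity_pos (hp : ∀ i, IsPriorDensity (p i)) (hz : z ∈ regularSet g) (i : Fin n) :
    0 < seamDensity p g z i :=
  div_pos ((hp i).pos _) (sv_pos hz i)

theorem IsSeparable.exists_ball_seamDensity_eq (hg : IsSeparable g) (hz : z ∈ regularSet g) :
    ∃ δ > 0, Metric.ball z δ ⊆ regularSet g ∧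
      ∀ w ∈ Metric.ball z δ, ∀ w' ∈ Metric.ball z δ, ∀ i, w i = w' i →
        seamDensity p g w i = seamDensity p g w' i := by
  obtain ⟨δ, hδ, hsub, h⟩ := hg.exists_ball_sv_eq hz
  refine ⟨δ, hδ, hsub, fun w hw w' hw' i hi => ?_⟩
  rw [seamDensity, seamDensity, h w hw w' hw' i hi, hi]

/-- If `f ∘ k` is locally a sum of functions of one coordinate each, its partial derivatives
`∂_i (f ∘ k) = ⟪V, ∂_i k⟫` do not vary with `z_j` for `j ≠ i`. Differentiating in `z_j`, the term
`⟪V, ∂_j ∂_i k⟫` drops out because mixed second derivatives are normal. -/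
theorem IsSeparable.inner_hessian_eq_zero (hk : IsSeparable k) (hp : ∀ i, IsPriorDensity (p i))
    (hz : z ∈ regularSet k) {f : E m → ℝ}
    (hf : ∀ᶠ w in 𝓝 z, f (k w) = Real.log (∏ i, seamDensity p k w i))
    {V : E m → E m} {A : E m →L[ℝ] E m}
    (hV : ∀ᶠ w in 𝓝 z, V (k w) ∈ LinearMap.range (fderiv ℝ k w).toLinearMap ∧
      HasFDerivAt (fun w => f (k w)) ((innerSL ℝ (V (k w))).comp (fderiv ℝ k w)) w)
    (hA : HasFDerivAt (fun w => V (k w)) (A.comp (fderiv ℝ k z)) z) {i j : Fin n} (hij : i ≠ j) :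
    ⟪A (partialD k z j), partialD k z i⟫ = 0 := by
  obtain ⟨δ, hδ, hsub, hown⟩ := hk.exists_ball_seamDensity_eq (p := p) hz
  have hball : ∀ᶠ w in 𝓝 z, w ∈ Metric.ball z δ := Metric.ball_mem_nhds z hδ
  have hgood := (hf.and (hV.and hball)).eventually_nhds
  have hsum : ∀ w ∈ Metric.ball z δ, Real.log (∏ i, seamDensity p k w i) =
      ∑ i, Real.log (seamDensity p k w i) := fun w hw =>
    Real.log_prod fun i _ => (seamDensity_pos hp (hsub hw) i).ne'
  have hline : ∀ (a : Fin n) (w : E n),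
      Tendsto (fun t : ℝ => w + t • (axis a : E n)) (𝓝 0) (𝓝 w) := fun a w => by
    simpa [ContinuousAt] using (hasDerivAt_line a w 0).continuousAt
  have hpart : ∀ w, HasFDerivAt (fun w => f (k w))
      ((innerSL ℝ (V (k w))).comp (fderiv ℝ k w)) w →
      HasDerivAt (fun t : ℝ => f (k (w + t • (axis i : E n)))) ⟪V (k w), partialD k w i⟫ 0 := by
    intro w hw
    exact hw.comp_hasDerivAt_of_eq (0 : ℝ) (hasDerivAt_line i w 0) (by simp)
  have hconst : (fun r : ℝ => ⟪V (k (z + r • (axis j : E n))), partialD k (z + r • axis j) i⟫)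
      =ᶠ[𝓝 0] fun _ => ⟪V (k z), partialD k z i⟫ := by
    filter_upwards [(hline j z).eventually hgood] with r hr
    set w := z + r • (axis j : E n) with hw
    have h1 := hpart w hr.self_of_nhds.2.1.2
    have h2 := hpart z hgood.self_of_nhds.self_of_nhds.2.1.2
    refine h1.unique ((h2.add_const (f (k w) - f (k z))).congr_of_eventuallyEq ?_)
    filter_upwards [(hline i w).eventually hr, (hline i z).eventually hgood.self_of_nhds]
      with t ht ht'
    have e1 := hr.self_of_nhds
    have e0 := hgood.self_of_nhds.self_of_nhds
    rw [ht.1, ht'.1, e1.1, e0.1, hsum _ ht.2.2, hsum _ ht'.2.2, hsum _ e1.2.2, hsum _ e0.2.2,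
      ← Finset.sum_sub_distrib, ← Finset.sum_add_distrib]
    refine Finset.sum_congr rfl fun l _ => ?_
    by_cases hl : l = j
    · rw [hown _ ht.2.2 _ e1.2.2 l (by simp [hl, Ne.symm hij]),
        hown _ ht'.2.2 _ e0.2.2 l (by simp [hl, Ne.symm hij])]
      ring
    · rw [hown _ ht.2.2 _ ht'.2.2 l (by simp [hw, hl]), hown _ e1.2.2 _ e0.2.2 l (by simp [hw, hl])]
      ring
  have hder : HasDerivAt
      (fun r : ℝ => ⟪V (k (z + r • (axis j : E n))), partialD k (z + r • axis j) i⟫)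
      (⟪V (k z), partialD2 k z j i⟫ + ⟪A (partialD k z j), partialD k z i⟫) 0 := by
    have h1 : HasDerivAt (fun r : ℝ => V (k (z + r • (axis j : E n)))) (A (partialD k z j)) 0 :=
      hA.comp_hasDerivAt_of_eq (0 : ℝ) (hasDerivAt_line j z 0) (by simp)
    have h2 : HasDerivAt (fun r : ℝ => partialD k (z + r • (axis j : E n)) i)
        (partialD2 k z j i) 0 :=
      (hasFDerivAt_partialD hz i).comp_hasDerivAt_of_eq (0 : ℝ) (hasDerivAt_line j z 0) (by simp)
    simpa using h1.inner ℝ h2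
  have h0 := hder.unique ((hasDerivAt_const (0 : ℝ) _).congr_of_eventuallyEq hconst)
  have hnormal : ⟪V (k z), partialD2 k z j i⟫ = 0 := by
    obtain ⟨v, hv⟩ := hV.self_of_nhds.1
    rw [← hv, ContinuousLinearMap.coe_coe, map_eq_sum_axis, sum_inner]
    refine Finset.sum_eq_zero fun l _ => ?_
    rw [real_inner_smul_left]
    have := hk.inner_partialD_partialD2 hz (Ne.symm hij) l
    rw [partialD] at this
    rw [this, mul_zero]
  linarith

theorem IsSeparable.exists_smul_eq_of_inner (hk : IsSeparable k) (hz : z ∈ regularSet k)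
    {j : Fin n} {u : E m} (hu : u ∈ LinearMap.range (fderiv ℝ k z).toLinearMap)
    (h : ∀ i, i ≠ j → ⟪u, partialD k z i⟫ = 0) : ∃ c : ℝ, u = c • partialD k z j := by
  obtain ⟨v, hv⟩ := hu
  have hu' : u = ∑ l, v l • partialD k z l := by
    rw [← hv, ContinuousLinearMap.coe_coe, map_eq_sum_axis]
    rfl
  have hcoef : ∀ i, i ≠ j → v i = 0 := fun i hi => by
    have := h i hi
    rw [hu', sum_inner, Finset.sum_eq_single i, real_inner_smul_left,
      real_inner_self_eq_norm_sq] at this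
    · exact (mul_eq_zero.1 this).resolve_right (pow_ne_zero 2 (sv_pos hz i).ne')
    · intro l _ hl
      rw [real_inner_smul_left, hk.inner_eq_zero z hz l i hl, mul_zero]
    · simp
  refine ⟨v j, ?_⟩
  rw [hu', Finset.sum_eq_single j]
  · intro i _ hi
    rw [hcoef i hi, zero_smul]
  · simp

/-- In any separable chart `k` of the manifold in which the density is the product of the seam
densities, the Jacobian columns are eigenvectors of the tangent Hessian of the log-density. -/
theorem IsSeparable.hessian_apply_partialD (hk : IsSeparable k) (hkg : IsGenerative k)
    (hrange : range k = range g) (hp : ∀ i, IsPriorDensity (p i)) (hz : z ∈ regularSet k)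
    (hdens : ∀ᶠ w in 𝓝 z, manifoldDensity p g (k w) = ∏ i, seamDensity p k w i)
    (htan : ∀ᶠ w in 𝓝 z, tangentSpaceAt g (k w) = LinearMap.range (fderiv ℝ k w).toLinearMap)
    {x : E m} (hx : x = k z) {H : Module.End ℝ (tangentSpaceAt g x)}
    (hH : IsTangentHessian g (fun x => Real.log (manifoldDensity p g x)) x H) (j : Fin n)
    (v : tangentSpaceAt g x) (hv : (v : E m) = partialD k z j) : ∃ c : ℝ, H v = c • v := by
  subst hx
  obtain ⟨V, A, hV, hA, hHA⟩ := hH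
  rw [← hrange] at hV hA
  have hmaps : MapsTo k univ (range k) := fun w _ => mem_range_self w
  have htend : Tendsto k (𝓝 z) (𝓝[range k] (k z)) :=
    tendsto_nhdsWithin_iff.2 ⟨hkg.isEmbedding.continuous.continuousAt,
      Eventually.of_forall mem_range_self⟩
  have hzero : ∀ i, i ≠ j → ⟪A (partialD k z j), partialD k z i⟫ = 0 := fun i hi => by
    refine hk.inner_hessian_eq_zero hp hz (V := V)
      (f := fun x => Real.log (manifoldDensity p g x)) ?_ ?_ ?_ hi
    · filter_upwards [hdens] with w hw
      rw [hw]
    · filter_upwards [htend.eventually hV, htan, (isOpen_regularSet k).mem_nhds hz]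
        with w hw hwT hwR
      refine ⟨hwT ▸ hw.1, ?_⟩
      have h2 := hw.2
      rw [← hrange] at h2
      exact hasFDerivWithinAt_univ.1
        (h2.comp w (hasFDerivAt_of_mem hwR).hasFDerivWithinAt hmaps)
    · exact hasFDerivWithinAt_univ.1
        (hA.comp z (hasFDerivAt_of_mem hz).hasFDerivWithinAt hmaps)
  have hT := htan.self_of_nhds
  obtain ⟨c, hc⟩ := hk.exists_smul_eq_of_inner hz (j := j) (u := (H v : E m))
    (hT ▸ (H v).2) fun i hi => by
      have hi' : partialD k z i ∈ tangentSpaceAt g (k z) := by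
        rw [hT]
        exact ⟨axis i, rfl⟩
      have h1 := Submodule.inner_orthogonalProjectionOnto_eq_of_mem_right
        (K := tangentSpaceAt g (k z)) ⟨_, hi'⟩ (A (v : E m))
      rw [← hHA v, hv] at h1
      exact h1.trans (hzero i hi)
  refine ⟨c, Subtype.ext ?_⟩
  rw [hc, Submodule.coe_smul, hv]

end Hessian

/-- Two eigenvector bases of an operator with simple spectrum agree up to order and scaling, so
each column of the Jacobian of the transition map has at most one nonzero entry. -/
theorem IsChartPair.transD_mul_transD_eq_zero_of_hessian {n m : ℕ} {p : Fin n → ℝ → ℝ}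
    {g d : E n → E m} {z : E n} (h : IsChartPair g d) (hgS : IsSeparable g) (hdS : IsSeparable d)
    (hp : ∀ i, IsPriorDensity (p i)) (hmatch : (latentLaw p).map d = (latentLaw p).map g)
    (hz : z ∈ commonReg d g) {x : E m} (hx : x = d z) {H : Module.End ℝ (tangentSpaceAt g x)}
    (hH : IsTangentHessian g (fun x => Real.log (manifoldDensity p g x)) x H)
    (hspec : SimpleSpectrum H) (i k l : Fin n) (hkl : k ≠ l) :
    transD g d z k i * transD g d z l i = 0 := by
  obtain ⟨hzd, hzg⟩ := h.mem_commonReg_iff.1 hz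
  set z' := transition g d z with hz'
  have hxg : x = g z' := hx.trans (h.apply_transition z).symm
  have hTg : ∀ w, tangentSpaceAt g (g w) = LinearMap.range (fderiv ℝ g w).toLinearMap :=
    fun w => by rw [tangentSpaceAt, invFun_apply h.left]
  have hT : tangentSpaceAt g x = LinearMap.range (fderiv ℝ g z').toLinearMap := by rw [hxg, hTg]
  let v : Fin n → tangentSpaceAt g x := fun a => ⟨partialD g z' a, by rw [hT]; exact ⟨_, rfl⟩⟩
  have hli : LinearIndependent ℝ v := by
    have h1 : LinearIndependent ℝ (fun a => partialD g z' a) := by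
      have := (EuclideanSpace.basisFun (Fin n) ℝ).toBasis.linearIndependent.map'
        (fderiv ℝ g z').toLinearMap (LinearMap.ker_eq_bot.2 hzg.2)
      convert! this using 1
      ext1 a
      simp [partialD]
    exact LinearIndependent.of_comp (tangentSpaceAt g x).subtype h1
  have hveig : ∀ a, ∃ c : ℝ, H (v a) = c • v a := fun a =>
    hgS.hessian_apply_partialD h.left rfl hp hzg
      (by
        filter_upwards [(isOpen_regularSet g).mem_nhds hzg] with w hw
        exact manifoldDensity_apply h.left hgS hw)
      (Eventually.of_forall hTg) hxg hH a (v a) rfl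
  choose c hc using hveig
  let w : tangentSpaceAt g x := ∑ a, transD g d z a i • v a
  have hw : (w : E m) = partialD d z i := by
    rw [h.partialD_eq_sum hz]
    simp [w, v, hz']
  obtain ⟨μ, hμ⟩ := hdS.hessian_apply_partialD h.right h.range_eq hp hzd
    (by
      filter_upwards [h.isOpen_commonReg.mem_nhds hz] with w hw
      exact h.manifoldDensity_apply_right hgS hdS hp hmatch hw)
    (by
      filter_upwards [h.isOpen_commonReg.mem_nhds hz] with w hw
      rw [h.range_fderiv_eq hw, ← h.apply_transition, hTg]) hx hH i w hw
  have hcoef : ∀ a, transD g d z a i * (c a - μ) = 0 := by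
    refine Fintype.linearIndependent_iff.1 hli _ ?_
    have h1 : H w = ∑ a, (transD g d z a i * c a) • v a := by
      simp only [w, map_sum, map_smul, hc, smul_smul]
    have h2 : μ • w = ∑ a, (transD g d z a i * μ) • v a := by
      simp only [w, Finset.smul_sum, smul_smul, mul_comm]
    simp only [mul_sub, sub_smul, Finset.sum_sub_distrib, ← h1, ← h2, hμ, sub_self]
  by_contra hne
  obtain ⟨hk, hl⟩ := mul_ne_zero_iff.1 hne
  have hck : c k = μ := sub_eq_zero.1 ((mul_eq_zero.1 (hcoef k)).resolve_left hk)
  have hcl : c l = μ := sub_eq_zero.1 ((mul_eq_zero.1 (hcoef l)).resolve_left hl)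
  have hmem : ∀ a, c a = μ → v a ∈ Module.End.eigenspace H μ := fun a ha => by
    rw [Module.End.mem_eigenspace_iff, hc, ha]
  -- Both `v k` and `v l` lie in the `μ`-eigenspace, which is at most a line.
  have hli2 : LinearIndependent ℝ
      (![⟨v k, hmem k hck⟩, ⟨v l, hmem l hcl⟩] : Fin 2 → Module.End.eigenspace H μ) := by
    refine LinearIndependent.of_comp (Module.End.eigenspace H μ).subtype ?_
    have := hli.comp ![k, l] (by
      intro a b
      fin_cases a <;> fin_cases b <;> simp [hkl, Ne.symm hkl])
    convert! this using 1
    ext1 a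
    fin_cases a <;> rfl
  have h2 := hli2.fintype_card_le_finrank
  have h1 := hspec μ
  simp only [Fintype.card_fin] at h2
  omega

/-- At every common regular point the Jacobian of the transition map is a generalised permutation
matrix: by the Hessian almost everywhere, and then everywhere by continuity. -/
theorem IsChartPair.transD_mul_transD_eq_zero {n m : ℕ} {p : Fin n → ℝ → ℝ}
    {g d : E n → E m} (h : IsChartPair g d) (hgS : IsSeparable g) (hdS : IsSeparable d)
    (hp : ∀ i, IsPriorDensity (p i)) (hmatch : (latentLaw p).map d = (latentLaw p).map g)
    (hspec : ∀ᵐ z, ∃ H : Module.End ℝ (tangentSpaceAt g (g z)),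
      IsTangentHessian g (fun x => Real.log (manifoldDensity p g x)) (g z) H ∧ SimpleSpectrum H)
    {z : E n} (hz : z ∈ commonReg d g) (i k l : Fin n) (hkl : k ≠ l) :
    transD g d z k i * transD g d z l i = 0 := by
  refine eq_zero_of_ae_of_continuousOn h.isOpen_commonReg
    (f := fun z => transD g d z k i * transD g d z l i)
    ((h.continuousOn_transD k i).mul (h.continuousOn_transD l i)) ?_ z hz
  filter_upwards [(h.quasiMeasurePreserving_transition hp hmatch).ae hspec] with w hw hwΩ
  obtain ⟨H, hH, hs⟩ := hw
  exact h.transD_mul_transD_eq_zero_of_hessian hgS hdS hp hmatch hwΩ (h.apply_transition w) hH hs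
    i k l hkl

/-! ### The permutation, the signs and the seam constants -/

/-- Two separable charts of one manifold whose seam densities have equal products, and whose
transition map has at most one nonzero entry in each column of its Jacobian. -/
structure IsMonomialPair {n m : ℕ} (p : Fin n → ℝ → ℝ) (g d : E n → E m) : Prop where
  pair : IsChartPair g d
  sep_left : IsSeparable g
  sep_right : IsSeparable d
  prior : ∀ i, IsPriorDensity (p i)
  prod_eq : ∀ z ∈ commonReg d g,
    ∏ i, seamDensity p d z i = ∏ i, seamDensity p g (transition g d z) i
  mul_eq_zero : ∀ z ∈ commonReg d g, ∀ i k l, k ≠ l → transD g d z k i * transD g d z l i = 0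

/-- `σ` is the pattern of nonzero entries of the Jacobian of the transition map at `z`. -/
def IsPermAt {n m : ℕ} (g d : E n → E m) (z : E n) (σ : Equiv.Perm (Fin n)) : Prop :=
  ∀ i k, transD g d z k i ≠ 0 ↔ k = σ i

section Perm

variable {n m : ℕ} {p : Fin n → ℝ → ℝ} {g d : E n → E m} {z : E n} {σ : Equiv.Perm (Fin n)}

theorem IsPermAt.ne_zero (hσ : IsPermAt g d z σ) (i : Fin n) : transD g d z (σ i) i ≠ 0 :=
  (hσ i _).2 rfl

theorem IsPermAt.eq_zero (hσ : IsPermAt g d z σ) {i k : Fin n} (h : k ≠ σ i) :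
    transD g d z k i = 0 :=
  not_not.1 fun h0 => h ((hσ i k).1 h0)

theorem IsPermAt.fderiv_axis (hσ : IsPermAt g d z σ) (i : Fin n) :
    fderiv ℝ (transition g d) z (axis i) = transD g d z (σ i) i • axis (σ i) := by
  ext k
  by_cases hk : k = σ i
  · subst hk
    simp [transD]
  · have := hσ.eq_zero hk
    rw [transD] at this
    simp [this, hk]

theorem IsPermAt.partialD_eq (h : IsChartPair g d) (hz : z ∈ commonReg d g)
    (hσ : IsPermAt g d z σ) (i : Fin n) :
    partialD d z i = transD g d z (σ i) i • partialD g (transition g d z) (σ i) := by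
  rw [h.partialD_eq_sum hz, Finset.sum_eq_single (σ i)]
  · intro k _ hk
    rw [hσ.eq_zero hk, zero_smul]
  · simp

theorem IsPermAt.sv_eq (h : IsChartPair g d) (hz : z ∈ commonReg d g)
    (hσ : IsPermAt g d z σ) (i : Fin n) :
    sv d z i = |transD g d z (σ i) i| * sv g (transition g d z) (σ i) := by
  rw [sv, hσ.partialD_eq h hz, norm_smul, Real.norm_eq_abs, sv]

theorem IsPermAt.leftVec_eq (h : IsChartPair g d) (hz : z ∈ commonReg d g)
    (hσ : IsPermAt g d z σ) {i : Fin n} {ε : ℝ}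
    (hε : transD g d z (σ i) i = ε * |transD g d z (σ i) i|) :
    leftVec d z i = ε • leftVec g (transition g d z) (σ i) := by
  have ha : |transD g d z (σ i) i| ≠ 0 := abs_ne_zero.2 (hσ.ne_zero i)
  have hs : sv g (transition g d z) (σ i) ≠ 0 := (sv_pos (h.mem_commonReg_iff.1 hz).2 _).ne'
  rw [leftVec, hσ.sv_eq h hz, hσ.partialD_eq h hz, leftVec, smul_smul, smul_smul]
  congr 1
  rw [hε, abs_mul, abs_abs]
  have hε1 : |ε| = 1 := by
    have := congrArg abs hε
    rw [abs_mul, abs_abs] at this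
    exact mul_right_cancel₀ ha (by rw [← this, one_mul])
  rw [hε1]
  field_simp

/-- The transition maps are mutually inverse, so their Jacobians have inverse patterns. -/
theorem IsPermAt.symm (h : IsChartPair g d) (hz : z ∈ commonReg d g) (hσ : IsPermAt g d z σ) :
    IsPermAt d g (transition g d z) σ.symm := by
  have hcomp := (h.symm.hasFDerivAt_transition (h.transition_mem_commonReg hz)).comp z
    (h.hasFDerivAt_transition hz)
  have hid : transition d g ∘ transition g d = id := funext h.transition_transition
  rw [hid] at hcomp
  have hinv := hcomp.unique (hasFDerivAt_id z)
  intro k l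
  obtain ⟨i, rfl⟩ := σ.surjective k
  have h1 := congrArg (fun A : E n →L[ℝ] E n => A (axis i) l) hinv
  simp only [ContinuousLinearMap.comp_apply, hσ.fderiv_axis, map_smul, PiLp.smul_apply,
    smul_eq_mul, ContinuousLinearMap.id_apply] at h1
  rw [Equiv.symm_apply_apply]
  have ha := hσ.ne_zero i
  change transD g d z (σ i) i * transD d g (transition g d z) l (σ i) = _ at h1
  by_cases hl : l = i
  · subst hl
    simp only [PiLp.single_apply, if_true] at h1
    exact iff_of_true (right_ne_zero_of_mul (h1 ▸ one_ne_zero)) rfl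
  · simp only [PiLp.single_apply, if_neg hl] at h1
    simpa [hl, ha] using h1

namespace IsMonomialPair

variable (M : IsMonomialPair p g d)
include M

/-- No column of the invertible Jacobian vanishes, and two columns cannot be multiples of the same
basis vector. -/
theorem exists_isPermAt (hz : z ∈ commonReg d g) : ∃ σ, IsPermAt g d z σ := by
  have hinj := M.pair.injective_fderiv_transition hz
  have hex : ∀ i, ∃ k, transD g d z k i ≠ 0 := fun i => by
    by_contra! hall
    have h0 : (axis i : E n) = 0 := hinj (by
      rw [map_zero]
      ext k
      exact hall k)
    simpa using congrArg (fun v : E n => v i) h0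
  choose f hf using hex
  have hf0 : ∀ i k, k ≠ f i → transD g d z k i = 0 := fun i k hk =>
    (_root_.mul_eq_zero.1 (M.mul_eq_zero z hz i k (f i) hk)).resolve_right (hf i)
  have hfinj : Function.Injective f := by
    intro i j hij
    by_contra hne
    have h0 : transD g d z (f i) j • (axis i : E n) = transD g d z (f i) i • axis j := hinj (by
      ext k
      simp only [map_smul, PiLp.smul_apply, smul_eq_mul]
      change _ * transD g d z k i = _ * transD g d z k j
      by_cases hk : k = f i
      · rw [hk, mul_comm]
      · rw [hf0 i k hk, hf0 j k (hij ▸ hk), mul_zero, mul_zero])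
    have := congrArg (fun v : E n => v i) h0
    simp [hne] at this
    exact hf j (hij ▸ this)
  refine ⟨Equiv.ofBijective f (Finite.injective_iff_bijective.1 hfinj), fun i k => ?_⟩
  refine ⟨fun hk => not_not.1 fun hne => hk (hf0 i k hne), ?_⟩
  rintro rfl
  exact hf i

theorem symm : IsMonomialPair p d g where
  pair := M.pair.symm
  sep_left := M.sep_right
  sep_right := M.sep_left
  prior := M.prior
  prod_eq z hz := by
    rw [M.prod_eq _ (M.pair.symm.transition_mem_commonReg hz), M.pair.symm.transition_transition]
  mul_eq_zero z hz i k l hkl := by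
    have hz' := M.pair.symm.transition_mem_commonReg hz
    obtain ⟨σ, hσ⟩ := M.exists_isPermAt hz'
    have hτ := hσ.symm M.pair hz'
    rw [M.pair.symm.transition_transition] at hτ
    by_cases hk : k = σ.symm i
    · rw [hτ.eq_zero (fun hl => hkl (hk.trans hl.symm)), mul_zero]
    · rw [hτ.eq_zero hk, zero_mul]

theorem eventually_sign_transD (hz : z ∈ commonReg d g) :
    ∀ᶠ w in 𝓝 z, ∀ i k, SignType.sign (transD g d w k i) = SignType.sign (transD g d z k i) := by
  obtain ⟨σ, hσ⟩ := M.exists_isPermAt hz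
  have hΩ := M.pair.isOpen_commonReg.mem_nhds hz
  have hcont : ∀ k i, ContinuousAt (fun w => transD g d w k i) z := fun k i =>
    (M.pair.continuousOn_transD k i).continuousAt hΩ
  refine eventually_all.2 fun i => ?_
  have hσi : ∀ᶠ w in 𝓝 z, SignType.sign (transD g d w (σ i) i) =
      SignType.sign (transD g d z (σ i) i) := by
    rcases lt_or_gt_of_ne (hσ.ne_zero i) with hlt | hgt
    · filter_upwards [(hcont (σ i) i).eventually_lt_const hlt] with w hw
      rw [sign_neg hw, sign_neg hlt]
    · filter_upwards [(hcont (σ i) i).eventually_const_lt hgt] with w hw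
      rw [sign_pos hw, sign_pos hgt]
  refine eventually_all.2 fun k => ?_
  by_cases hk : k = σ i
  · rwa [hk]
  · filter_upwards [hσi, hΩ] with w hw hwΩ
    have hne : transD g d w (σ i) i ≠ 0 := fun h0 => by
      rw [h0, sign_zero, eq_comm, sign_eq_zero_iff] at hw
      exact hσ.ne_zero i hw
    rw [hσ.eq_zero hk,
      (_root_.mul_eq_zero.1 (M.mul_eq_zero w hwΩ i k (σ i) hk)).resolve_right hne]

omit M in
theorem isPermAt_of_sign_eq {w : E n} (hσ : IsPermAt g d z σ)
    (h : ∀ i k, SignType.sign (transD g d w k i) = SignType.sign (transD g d z k i)) :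
    IsPermAt g d w σ := fun i k => by
  rw [← hσ i k, ← sign_ne_zero (a := transD g d w k i), h, sign_ne_zero]

/-- Near `z`, the quotient of the `i`-th seam densities depends on `z_i` alone. The product of
these quotients over `i` is one, so each of them is locally constant. -/
theorem eventually_ratio_eq (hz : z ∈ commonReg d g) (hσ : IsPermAt g d z σ) :
    ∀ᶠ w in 𝓝 z, ∀ i,
      seamDensity p d w i / seamDensity p g (transition g d w) (σ i) =
        seamDensity p d z i / seamDensity p g (transition g d z) (σ i) := by
  obtain ⟨hzd, hzg⟩ := M.pair.mem_commonReg_iff.1 hz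
  obtain ⟨δ₁, hδ₁, -, h₁⟩ := M.sep_right.exists_ball_seamDensity_eq (p := p) hzd
  obtain ⟨δ₂, hδ₂, -, h₂⟩ := M.sep_left.exists_ball_seamDensity_eq (p := p) hzg
  have hev : ∀ᶠ w in 𝓝 z, w ∈ commonReg d g ∧ w ∈ Metric.ball z δ₁ ∧
      transition g d w ∈ Metric.ball (transition g d z) δ₂ ∧ IsPermAt g d w σ := by
    filter_upwards [M.pair.isOpen_commonReg.mem_nhds hz, Metric.ball_mem_nhds z hδ₁,
      M.pair.continuous_transition.continuousAt.eventually (Metric.ball_mem_nhds _ hδ₂),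
      M.eventually_sign_transD hz] with w w1 w2 w3 w4
    exact ⟨w1, w2, w3, isPermAt_of_sign_eq hσ w4⟩
  obtain ⟨δ, hδ, hball⟩ := Metric.eventually_nhds_iff_ball.1 hev
  set r : E n → Fin n → ℝ := fun w i =>
    seamDensity p d w i / seamDensity p g (transition g d w) (σ i) with hr
  have hrpos : ∀ w ∈ Metric.ball z δ, ∀ i, 0 < r w i := fun w hw i =>
    div_pos (seamDensity_pos M.prior (M.pair.mem_commonReg_iff.1 (hball w hw).1).1 i)
      (seamDensity_pos M.prior (M.pair.mem_commonReg_iff.1 (hball w hw).1).2 _)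
  have hprod : ∀ w ∈ Metric.ball z δ, ∏ i, r w i = 1 := fun w hw => by
    have h0 : ∏ i, seamDensity p g (transition g d w) i ≠ 0 := Finset.prod_ne_zero_iff.2 fun i _ =>
      (seamDensity_pos M.prior (M.pair.mem_commonReg_iff.1 (hball w hw).1).2 i).ne'
    rw [hr, Finset.prod_div_distrib,
      Equiv.prod_comp σ fun i => seamDensity p g (transition g d w) i, M.prod_eq w (hball w hw).1,
      div_self h0]
  have hown : ∀ w ∈ Metric.ball z δ, ∀ w' ∈ Metric.ball z δ, ∀ i, w i = w' i → r w i = r w' i := by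
    intro w hw w' hw' i hi
    have hcoord : transition g d w (σ i) = transition g d w' (σ i) :=
      eq_of_coord_eq (f := fun w => transition g d w (σ i)) (i := i) (z := z) (δ := δ)
        (fun v hv => (M.pair.hasFDerivAt_transition_apply (hball v hv).1 _).differentiableAt)
        (fun v hv j hj => by
          rw [M.pair.fderiv_transition_apply (hball v hv).1]
          exact (hball v hv).2.2.2.eq_zero fun h => hj (σ.injective h).symm) hw hw' hi
    simp only [hr]
    rw [h₁ w (hball w hw).2.1 w' (hball w' hw').2.1 i hi,
      h₂ _ (hball w hw).2.2.1 _ (hball w' hw').2.2.1 _ hcoord]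
  filter_upwards [Metric.ball_mem_nhds z hδ] with w hw i
  -- Move from `z` in the `i`-th coordinate only: this changes no other factor of the product.
  set w' : E n := z + (w i - z i) • axis i with hw'
  have hw'mem : w' ∈ Metric.ball z δ := by
    rw [Metric.mem_ball, hw', dist_eq_norm, add_sub_cancel_left, norm_smul]
    have h1 : ‖w i - z i‖ ≤ ‖w - z‖ := by simpa using PiLp.norm_apply_le (w - z) i
    have h2 : ‖w - z‖ < δ := by rwa [← dist_eq_norm]
    simpa using h1.trans_lt h2
  have hzmem : z ∈ Metric.ball z δ := Metric.mem_ball_self hδ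
  have e1 := hprod w' hw'mem
  rw [← hprod z hzmem, ← Finset.mul_prod_erase _ _ (Finset.mem_univ i),
    ← Finset.mul_prod_erase _ (r z) (Finset.mem_univ i)] at e1
  have e2 : ∏ l ∈ Finset.univ.erase i, r w' l = ∏ l ∈ Finset.univ.erase i, r z l :=
    Finset.prod_congr rfl fun l hl => hown _ hw'mem _ hzmem l (by
      simp [hw', Finset.ne_of_mem_erase hl])
  rw [e2, hown w' hw'mem w hw i (by simp [hw'])] at e1
  exact mul_right_cancel₀
    (Finset.prod_ne_zero_iff.2 fun l _ => (hrpos z hzmem l).ne') e1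

/-- The sign pattern and the quotients of seam densities, locally constant, are constant on
connected sets. -/
theorem sign_and_ratio_eq {C : Set (E n)} (hC : C ⊆ commonReg d g) (hpre : IsPreconnected C)
    {w : E n} (hw : w ∈ C) (hz : z ∈ C) :
    (∀ i k, SignType.sign (transD g d w k i) = SignType.sign (transD g d z k i)) ∧
      ∀ σ, IsPermAt g d z σ → ∀ i,
        seamDensity p d w i / seamDensity p g (transition g d w) (σ i) =
          seamDensity p d z i / seamDensity p g (transition g d z) (σ i) := by
  refine hpre.induction₂ (fun z w =>
    (∀ i k, SignType.sign (transD g d w k i) = SignType.sign (transD g d z k i)) ∧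
      ∀ σ, IsPermAt g d z σ → ∀ i,
        seamDensity p d w i / seamDensity p g (transition g d w) (σ i) =
          seamDensity p d z i / seamDensity p g (transition g d z) (σ i)) ?_ ?_ ?_ hz hw
  · intro x hx
    obtain ⟨σ, hσ⟩ := M.exists_isPermAt (hC hx)
    refine nhdsWithin_le_nhds ?_
    filter_upwards [M.eventually_sign_transD (hC hx), M.eventually_ratio_eq (hC hx) hσ]
      with y h1 h2
    refine ⟨h1, fun σ' hσ' => ?_⟩
    have : σ' = σ := Equiv.ext fun i => (hσ i _).1 (hσ'.ne_zero i)
    rwa [this]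
  · intro x y v _ _ _ hxy hyv
    exact ⟨fun i k => (hyv.1 i k).trans (hxy.1 i k), fun σ hσ i =>
      (hyv.2 σ (isPermAt_of_sign_eq hσ hxy.1) i).trans (hxy.2 σ hσ i)⟩
  · intro x y _ _ hxy
    exact ⟨fun i k => (hxy.1 i k).symm, fun σ hσ i =>
      (hxy.2 σ (isPermAt_of_sign_eq hσ fun i k => (hxy.1 i k).symm) i).symm⟩

theorem seam_subset (hσ : IsPermAt g d z σ) (i : Fin n) :
    seam d (commonReg d g) i z ⊆ seam g (commonReg g d) (σ i) (transition g d z) := by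
  intro y hy
  rw [mem_seam_iff M.pair.right (fun _ h => h.1)] at hy
  rw [mem_seam_iff M.pair.left (fun _ h => h.1)]
  obtain ⟨T, hT, hseg⟩ := hy
  have hlc : Continuous fun t : ℝ => z + t • (axis i : E n) := by fun_prop
  have hperm : ∀ t ∈ uIcc 0 T, IsPermAt g d (z + t • axis i) σ := fun t ht => by
    refine isPermAt_of_sign_eq hσ (M.sign_and_ratio_eq
      (C := (fun t : ℝ => z + t • (axis i : E n)) '' uIcc 0 T) ?_ ?_ ⟨t, ht, rfl⟩
      ⟨0, left_mem_uIcc, by simp⟩).1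
    · rintro _ ⟨s, hs, rfl⟩
      exact hseg s hs
    · exact isPreconnected_uIcc.image _ hlc.continuousOn
  set b : ℝ → ℝ := fun t => transition g d (z + t • axis i) (σ i) - transition g d z (σ i) with hb
  have hb0 : b 0 = 0 := by simp [hb]
  have hbc : Continuous b :=
    ((EuclideanSpace.proj (𝕜 := ℝ) (σ i)).continuous.comp
      (M.pair.continuous_transition.comp hlc)).sub continuous_const
  -- The transition map carries the segment along axis `i` into a line along axis `σ i`.
  have hline : ∀ t ∈ uIcc 0 T,
      transition g d (z + t • axis i) = transition g d z + b t • axis (σ i) := fun t ht => by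
    ext k
    by_cases hk : k = σ i
    · subst hk
      simp [hb]
    · have := eq_of_hasDerivWithinAt_zero
        (f := fun s : ℝ => transition g d (z + s • (axis i : E n)) k) (convex_uIcc 0 T)
        (fun s hs => by
          have h1 := (M.pair.hasFDerivAt_transition_apply (hseg s hs) k).comp_hasDerivAt s
            (hasDerivAt_line i z s)
          have h2 : ((EuclideanSpace.proj (𝕜 := ℝ) k).comp
              (fderiv ℝ (transition g d) (z + s • axis i))) (axis i) = 0 :=
            (hperm s hs).eq_zero hk
          rw [h2] at h1
          exact h1.hasDerivWithinAt) ht left_mem_uIcc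
      simp only [zero_smul, add_zero] at this
      simp [this, hk]
  refine ⟨b T, ?_, fun s hs => ?_⟩
  · rw [← hline T right_mem_uIcc, M.pair.apply_transition, hT]
  · rw [← hb0] at hs
    obtain ⟨t, ht, rfl⟩ := intermediate_value_uIcc hbc.continuousOn hs
    rw [← hline t ht]
    exact M.pair.transition_mem_commonReg (hseg t ht)

theorem seam_eq (hz : z ∈ commonReg d g) (hσ : IsPermAt g d z σ) (i : Fin n) :
    seam d (commonReg d g) i z = seam g (commonReg g d) (σ i) (transition g d z) := by
  refine (M.seam_subset hσ i).antisymm ?_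
  have := M.symm.seam_subset (hσ.symm M.pair hz) (σ i)
  rwa [Equiv.symm_apply_apply, M.pair.transition_transition] at this

theorem exists_perm_sign_const {C : Set (E n)} (hC : C ⊆ commonReg d g)
    (hpre : IsPreconnected C) :
    ∃ (σ : Equiv.Perm (Fin n)) (ε c : Fin n → ℝ), (∀ i, ε i = 1 ∨ ε i = -1) ∧ (∀ i, 0 < c i) ∧
      ∏ i, c i = 1 ∧ ∀ z ∈ C, IsPermAt g d z σ ∧
        (∀ i, transD g d z (σ i) i = ε i * |transD g d z (σ i) i|) ∧
        ∀ i, seamDensity p d z i = c i * seamDensity p g (transition g d z) (σ i) := by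
  obtain rfl | ⟨z, hz⟩ := C.eq_empty_or_nonempty
  · exact ⟨1, 1, 1, by simp, by simp, by simp, by simp⟩
  obtain ⟨σ, hσ⟩ := M.exists_isPermAt (hC hz)
  have hpos : ∀ w ∈ C, ∀ i, 0 < seamDensity p d w i ∧
      0 < seamDensity p g (transition g d w) i := fun w hw i =>
    ⟨seamDensity_pos M.prior (M.pair.mem_commonReg_iff.1 (hC hw)).1 i,
      seamDensity_pos M.prior (M.pair.mem_commonReg_iff.1 (hC hw)).2 i⟩
  refine ⟨σ, fun i => (SignType.sign (transD g d z (σ i) i) : ℝ), fun i =>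
    seamDensity p d z i / seamDensity p g (transition g d z) (σ i), fun i => ?_,
    fun i => div_pos (hpos z hz i).1 (hpos z hz _).2, ?_, fun w hw => ?_⟩
  · rcases lt_or_gt_of_ne (hσ.ne_zero i) with h | h
    · right
      simp [sign_neg h]
    · left
      simp [sign_pos h]
  · rw [Finset.prod_div_distrib,
      Equiv.prod_comp σ fun i => seamDensity p g (transition g d z) i, M.prod_eq z (hC hz),
      div_self (Finset.prod_ne_zero_iff.2 fun i _ => (hpos z hz i).2.ne')]
  · obtain ⟨h1, h2⟩ := M.sign_and_ratio_eq hC hpre hw hz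
    refine ⟨isPermAt_of_sign_eq hσ h1, fun i => ?_, fun i => ?_⟩
    · simp only [← h1, sign_mul_abs]
    · simp only [← h2 σ hσ i]
      rw [div_mul_cancel₀ _ (hpos w hw _).2.ne']

theorem identifiesOn {C : Set (E n)} (hC : C ⊆ commonReg d g) {ε c : Fin n → ℝ}
    (h : ∀ z ∈ C, IsPermAt g d z σ ∧
        (∀ i, transD g d z (σ i) i = ε i * |transD g d z (σ i) i|) ∧
        ∀ i, seamDensity p d z i = c i * seamDensity p g (transition g d z) (σ i)) :
    IdentifiesOn p g d C σ ε c := by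
  have hreg : ∀ z ∈ C, ∀ z', g z' = d z → z' = transition g d z ∧ z' ∈ regularSet g :=
    fun z hz z' hz' => by
      have := M.pair.eq_transition hz'
      exact ⟨this, this ▸ (M.pair.mem_commonReg_iff.1 (hC hz)).2⟩
  have hfac : ∀ z ∈ C, manifoldDensity p g (d z) =
      ∏ i, seamDensity p g (transition g d z) i := fun z hz => by
    rw [← M.pair.apply_transition, manifoldDensity_apply M.pair.left M.sep_left
      (M.pair.mem_commonReg_iff.1 (hC hz)).2]
  constructor
  · exact fun z hz => M.sep_right.isSVD (M.pair.mem_commonReg_iff.1 (hC hz)).1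
  · exact fun z hz z' hz' => M.sep_left.isSVD (hreg z hz z' hz').2
  · exact fun z hz => (hfac z hz).trans (M.prod_eq z (hC hz)).symm
  · intro z hz z' hz'
    rw [(hreg z hz z' hz').1, hfac z hz]
  · intro z hz z' hz' i
    rw [(hreg z hz z' hz').1]
    exact (h z hz).1.leftVec_eq M.pair (hC hz) ((h z hz).2.1 i)
  · intro z hz z' hz' i
    rw [(hreg z hz z' hz').1]
    exact M.seam_eq (hC hz) (h z hz).1 i
  · intro z hz z' hz' i
    rw [(hreg z hz z' hz').1]
    exact (h z hz).2.2 i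

end IsMonomialPair

end Perm

/-! ### Distribution functions of the one-dimensional priors -/

section Cdf

open MeasureTheory ProbabilityTheory

variable {q r : ℝ → ℝ}

namespace IsPriorDensity

theorem integrable (hq : IsPriorDensity q) : Integrable q :=
  integrable_of_integral_eq_one hq.integral_eq_one

theorem isProbabilityMeasure_law1 (hq : IsPriorDensity q) : IsProbabilityMeasure (law1 q) := by
  refine ⟨?_⟩
  rw [law1, withDensity_apply _ MeasurableSet.univ, Measure.restrict_univ,
    ← ofReal_integral_eq_lintegral_ofReal hq.integrable (ae_of_all _ fun t => (hq.pos t).le),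
    hq.integral_eq_one, ENNReal.ofReal_one]

theorem cdf_eq_integral (hq : IsPriorDensity q) (x : ℝ) : cdf (law1 q) x = ∫ t in Iic x, q t := by
  have := hq.isProbabilityMeasure_law1
  rw [cdf_eq_real, Measure.real, law1, withDensity_apply _ measurableSet_Iic,
    ← ofReal_integral_eq_lintegral_ofReal hq.integrable.integrableOn
      (ae_of_all _ fun t => (hq.pos t).le),
    ENNReal.toReal_ofReal (setIntegral_nonneg measurableSet_Iic fun t _ => (hq.pos t).le)]

theorem hasDerivAt_cdf (hq : IsPriorDensity q) (t : ℝ) : HasDerivAt (cdf (law1 q)) (q t) t := by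
  have h1 : ∀ x, cdf (law1 q) x = (∫ s in (0 : ℝ)..x, q s) + cdf (law1 q) 0 := fun x => by
    rw [hq.cdf_eq_integral, hq.cdf_eq_integral, ← intervalIntegral.integral_Iic_sub_Iic
      hq.integrable.integrableOn hq.integrable.integrableOn, sub_add_cancel]
  have h2 := ((hq.continuous.integral_hasStrictDerivAt 0 t).hasDerivAt).add_const
    (cdf (law1 q) 0)
  exact h2.congr_of_eventuallyEq (Eventually.of_forall h1)

theorem strictMono_cdf (hq : IsPriorDensity q) : StrictMono (cdf (law1 q)) :=
  strictMono_of_deriv_pos fun t => by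
    rw [(hq.hasDerivAt_cdf t).deriv]
    exact hq.pos t

theorem cdf_neg (hq : IsPriorDensity q) (hr : IsPriorDensity r) (h : ∀ t, r (-t) = q t) (t : ℝ) :
    cdf (law1 r) (-t) = 1 - cdf (law1 q) t := by
  have hder : ∀ s, HasDerivAt (fun s => cdf (law1 r) (-s) + cdf (law1 q) s) 0 s := fun s => by
    have h1 := (hr.hasDerivAt_cdf (-s)).comp s (hasDerivAt_neg s)
    have h2 := h1.add (hq.hasDerivAt_cdf s)
    rw [h s, mul_neg_one, neg_add_cancel] at h2
    exact h2
  have hconst := is_const_of_deriv_eq_zero (fun s => (hder s).differentiableAt)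
    (fun s => (hder s).deriv) t
  have hlim : Tendsto (fun s => cdf (law1 r) (-s) + cdf (law1 q) s) atTop (𝓝 (0 + 1)) :=
    ((tendsto_cdf_atBot _).comp tendsto_neg_atTop_atBot).add (tendsto_cdf_atTop _)
  have hval : cdf (law1 r) (-t) + cdf (law1 q) t = 0 + 1 :=
    tendsto_nhds_unique (tendsto_const_nhds.congr fun s => hconst s) hlim
  linarith

/-- A surjection intertwining the distribution functions pushes one law to the other. -/
theorem map_law1_of_cdf_eq (hq : IsPriorDensity q) (hr : IsPriorDensity r) {τ : ℝ → ℝ}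
    (hτ : Function.Surjective τ) (hmono : StrictMono τ) (hm : Measurable τ)
    (h : ∀ t, cdf (law1 r) (τ t) = cdf (law1 q) t) : (law1 q).map τ = law1 r := by
  have := hq.isProbabilityMeasure_law1
  have := hr.isProbabilityMeasure_law1
  have := Measure.isProbabilityMeasure_map (μ := law1 q) hm.aemeasurable
  refine Measure.ext_of_Iic _ _ fun a => ?_
  obtain ⟨t, rfl⟩ := hτ a
  have hpre : τ ⁻¹' Iic (τ t) = Iic t := Set.ext fun s => hmono.le_iff_le
  rw [Measure.map_apply hm measurableSet_Iic, hpre, ← ofReal_cdf, ← ofReal_cdf, h]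

theorem map_law1_of_cdf_eq_one_sub (hq : IsPriorDensity q) (hr : IsPriorDensity r) {τ : ℝ → ℝ}
    (hτ : Function.Surjective τ) (hanti : StrictAnti τ) (hm : Measurable τ)
    (h : ∀ t, cdf (law1 r) (τ t) = 1 - cdf (law1 q) t) : (law1 q).map τ = law1 r := by
  have := hq.isProbabilityMeasure_law1
  have := hr.isProbabilityMeasure_law1
  have := Measure.isProbabilityMeasure_map (μ := law1 q) hm.aemeasurable
  refine Measure.ext_of_Iic _ _ fun a => ?_
  obtain ⟨t, rfl⟩ := hτ a
  have hpre : τ ⁻¹' Iic (τ t) = (Iio t)ᶜ := by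
    rw [compl_Iio]
    exact Set.ext fun s => hanti.le_iff_ge
  have hatom : law1 q (Iio t) = law1 q (Iic t) :=
    measure_congr (withDensity_absolutelyContinuous _ _ Iio_ae_eq_Iic)
  rw [Measure.map_apply hm measurableSet_Iic, hpre, prob_compl_eq_one_sub measurableSet_Iio, hatom,
    ← ofReal_cdf, ← ofReal_cdf, h, ENNReal.ofReal_sub _ (cdf_nonneg _ _), ENNReal.ofReal_one]

end IsPriorDensity

/-- Two distribution functions with affinely related ranges are equal up to a reflection: both
ranges have infimum `0` and supremum `1`. -/
theorem cdf_affine {μ ν : Measure ℝ} {a κ : ℝ}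
    (h₁ : ∀ t, ∃ s, cdf ν s = a * cdf μ t + κ) (h₂ : ∀ s, ∃ t, cdf ν s = a * cdf μ t + κ) :
    (0 < a → a = 1 ∧ κ = 0) ∧ (a < 0 → a = -1 ∧ κ = 1) := by
  have hmem : ∀ t, a * cdf μ t + κ ∈ Icc (0 : ℝ) 1 := fun t => by
    obtain ⟨s, hs⟩ := h₁ t
    exact hs ▸ ⟨cdf_nonneg _ _, cdf_le_one _ _⟩
  have hbot : a * 0 + κ ∈ Icc (0 : ℝ) 1 := isClosed_Icc.mem_of_tendsto
    (((tendsto_cdf_atBot μ).const_mul a).add_const κ) (Eventually.of_forall hmem)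
  have htop : a * 1 + κ ∈ Icc (0 : ℝ) 1 := isClosed_Icc.mem_of_tendsto
    (((tendsto_cdf_atTop μ).const_mul a).add_const κ) (Eventually.of_forall hmem)
  obtain ⟨hb0, hb1⟩ := hbot
  obtain ⟨ht0, ht1⟩ := htop
  constructor
  · intro ha
    have hν : ∀ s, cdf ν s ∈ Icc κ (a + κ) := fun s => by
      obtain ⟨t, ht⟩ := h₂ s
      have h0 := mul_nonneg ha.le (cdf_nonneg μ t)
      have h1 := mul_le_of_le_one_right ha.le (cdf_le_one μ t)
      rw [ht]
      constructor <;> linarith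
    have e0 := isClosed_Icc.mem_of_tendsto (tendsto_cdf_atBot ν) (Eventually.of_forall hν)
    have e1 := isClosed_Icc.mem_of_tendsto (tendsto_cdf_atTop ν) (Eventually.of_forall hν)
    constructor <;> linarith [e0.1, e1.2]
  · intro ha
    have hν : ∀ s, cdf ν s ∈ Icc (a + κ) κ := fun s => by
      obtain ⟨t, ht⟩ := h₂ s
      have h0 := mul_nonneg (neg_nonneg.2 ha.le) (cdf_nonneg μ t)
      have h1 := mul_le_of_le_one_right (neg_nonneg.2 ha.le) (cdf_le_one μ t)
      rw [ht]
      constructor <;> linarith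
    have e0 := isClosed_Icc.mem_of_tendsto (tendsto_cdf_atBot ν) (Eventually.of_forall hν)
    have e1 := isClosed_Icc.mem_of_tendsto (tendsto_cdf_atTop ν) (Eventually.of_forall hν)
    constructor <;> linarith [e0.1, e1.2]

end Cdf

/-! ### Independent components when the common regular set is connected -/

namespace IsMonomialPair

open ProbabilityTheory

variable {n m : ℕ} {p : Fin n → ℝ → ℝ} {g d : E n → E m} {σ : Equiv.Perm (Fin n)}
  {ε c : Fin n → ℝ}

/-- On the connected set, `F_{σ i}(z'_{σ i})` and `(ε_i / c_i) F_i(z_i)`, with `F` the distribution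
functions of the priors, have the same derivative; by density and continuity the affine relation
then holds on all of latent space. -/
theorem exists_cdf_transition_eq (M : IsMonomialPair p g d) (hdense : Dense (commonReg d g))
    (hpre : IsPreconnected (commonReg d g)) (hc : ∀ i, 0 < c i)
    (h : ∀ z ∈ commonReg d g, IsPermAt g d z σ ∧
        (∀ i, transD g d z (σ i) i = ε i * |transD g d z (σ i) i|) ∧
        ∀ i, seamDensity p d z i = c i * seamDensity p g (transition g d z) (σ i)) (i : Fin n) :
    ∃ κ, ∀ z, cdf (law1 (p (σ i))) (transition g d z (σ i)) =
      ε i / c i * cdf (law1 (p i)) (z i) + κ := by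
  set w : E n → ℝ := fun z => cdf (law1 (p (σ i))) (transition g d z (σ i)) -
    ε i / c i * cdf (law1 (p i)) (z i) with hw
  have hproj : ∀ z : E n, HasFDerivAt (fun z : E n => z i) (EuclideanSpace.proj (𝕜 := ℝ) i) z :=
    fun z => (EuclideanSpace.proj (𝕜 := ℝ) i).hasFDerivAt
  have hder : ∀ z ∈ commonReg d g, HasFDerivAt w 0 z := fun z hz => by
    obtain ⟨hσ, hε, hdens⟩ := h z hz
    have h1 := ((M.prior (σ i)).hasDerivAt_cdf (transition g d z (σ i))).comp_hasFDerivAt z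
      (M.pair.hasFDerivAt_transition_apply hz (σ i))
    have h2 := ((M.prior i).hasDerivAt_cdf (z i)).comp_hasFDerivAt z (hproj z)
    refine (h1.sub (h2.const_mul (ε i / c i))).congr_fderiv (ext_axis fun j => ?_)
    change p (σ i) (transition g d z (σ i)) * transD g d z (σ i) j -
      ε i / c i * (p i (z i) * (axis j : E n) i) = 0
    by_cases hj : j = i
    · subst hj
      have hs := (sv_pos (M.pair.mem_commonReg_iff.1 hz).2 (σ j)).ne'
      have ha := abs_ne_zero.2 (hσ.ne_zero j)
      have hd := hdens j
      rw [seamDensity, seamDensity, hσ.sv_eq M.pair hz j] at hd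
      have hp : p j (z j) = c j * p (σ j) (transition g d z (σ j)) *
          |transD g d z (σ j) j| := by
        field_simp at hd
        linarith
      rw [hp, hε j, abs_mul, abs_abs]
      have hε1 : |ε j| * |transD g d z (σ j) j| = |transD g d z (σ j) j| := by
        conv_rhs => rw [hε j, abs_mul, abs_abs]
      have := (hc j).ne'
      rw [hε1]
      simp only [PiLp.single_apply, if_true]
      field_simp
      ring
    · rw [hσ.eq_zero fun h => hj (σ.injective h).symm]
      simp [Ne.symm hj]
  obtain ⟨κ, hκ⟩ := M.pair.isOpen_commonReg.exists_is_const_of_fderiv_eq_zero hpre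
    (fun z hz => (hder z hz).differentiableAt.differentiableWithinAt)
    (fun z hz => (hder z hz).fderiv)
  have hcdf : ∀ j, Continuous (cdf (law1 (p j))) := fun j =>
    continuous_iff_continuousAt.2 fun t => ((M.prior j).hasDerivAt_cdf t).continuousAt
  have hwc : Continuous w := by
    refine ((hcdf _).comp ((EuclideanSpace.proj (𝕜 := ℝ) (σ i)).continuous.comp
      M.pair.continuous_transition)).sub (continuous_const.mul ((hcdf i).comp
        (EuclideanSpace.proj (𝕜 := ℝ) i).continuous))
  have hall := hwc.ext_on hdense continuous_const hκ
  refine ⟨κ, fun z => ?_⟩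
  have := congrFun hall z
  simp only [hw] at this
  linarith

theorem exists_coord_surj (M : IsMonomialPair p g d) (k : Fin n) (s : ℝ) :
    ∃ z, transition g d z k = s :=
  ⟨transition d g (s • axis k), by rw [M.pair.symm.transition_transition]; simp⟩

theorem const_eq_one (M : IsMonomialPair p g d) (hε : ∀ i, ε i = 1 ∨ ε i = -1) {i : Fin n}
    (hc : 0 < c i) {κ : ℝ}
    (h : ∀ z, cdf (law1 (p (σ i))) (transition g d z (σ i)) =
      ε i / c i * cdf (law1 (p i)) (z i) + κ) :
    c i = 1 ∧ (ε i = 1 → κ = 0) ∧ (ε i = -1 → κ = 1) := by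
  obtain ⟨hpos, hneg⟩ := cdf_affine (μ := law1 (p i)) (ν := law1 (p (σ i)))
    (a := ε i / c i) (κ := κ)
    (fun t => ⟨transition g d (t • axis i) (σ i), by rw [h]; simp⟩)
    (fun s => by
      obtain ⟨z, rfl⟩ := M.exists_coord_surj (σ i) s
      exact ⟨z i, h z⟩)
  rcases hε i with h1 | h1
  · obtain ⟨ha, hκ⟩ := hpos (by rw [h1]; positivity)
    rw [h1, div_eq_one_iff_eq hc.ne'] at ha
    exact ⟨ha.symm, fun _ => hκ, fun h2 => by norm_num [h1] at h2⟩
  · obtain ⟨ha, hκ⟩ := hneg (by rw [h1, neg_div]; exact neg_neg_of_pos (by positivity))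
    rw [h1, neg_div, neg_inj, div_eq_one_iff_eq hc.ne'] at ha
    exact ⟨ha.symm, fun h2 => by norm_num [h1] at h2, fun _ => hκ⟩

end IsMonomialPair

end SeamId

theorem mainTheorem2 {n m : ℕ} (p : Fin n → ℝ → ℝ) (hp : ∀ i, SeamId.IsPriorDensity (p i))
    (g d : SeamId.E n → SeamId.E m)
    (hg : SeamId.IsGenerative g) (hd : SeamId.IsGenerative d)
    (hgC : ∀ᵐ z, SeamId.C1 g z ∧ SeamId.C2 g z)
    (hdC : ∀ᵐ z, SeamId.C1 d z ∧ SeamId.C2 d z)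
    (hM : Set.range d = Set.range g)
    (hmatch : (SeamId.latentLaw p).map d = (SeamId.latentLaw p).map g)
    (hspec : ∀ᵐ z, ∃ H : Module.End ℝ (SeamId.tangentSpaceAt g (g z)),
      SeamId.IsTangentHessian g (fun x => Real.log (SeamId.manifoldDensity p g x)) (g z) H ∧
        SeamId.SimpleSpectrum H) :
    (∀ᵐ z, z ∈ SeamId.commonReg d g) ∧ (∀ᵐ z, z ∈ SeamId.commonReg g d) ∧
    (∀ C : Set (SeamId.E n), C ⊆ SeamId.commonReg d g → IsPreconnected C →
      ∃ (σ : Equiv.Perm (Fin n)) (ε c : Fin n → ℝ),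
        (∀ i, ε i = 1 ∨ ε i = -1) ∧ (∀ i, 0 < c i) ∧ ∏ i, c i = 1 ∧
        SeamId.IdentifiesOn p g d C σ ε c) ∧
    (IsPreconnected (SeamId.commonReg d g) →
      ∃ (σ : Equiv.Perm (Fin n)) (ε : Fin n → ℝ) (τ : Fin n → ℝ → ℝ),
        (∀ i, ε i = 1 ∨ ε i = -1) ∧
        SeamId.IdentifiesOn p g d (SeamId.commonReg d g) σ ε (fun _ => 1) ∧
        (∀ i, Continuous (τ i) ∧ Function.Bijective (τ i) ∧
          (ε i = 1 → StrictMono (τ i)) ∧ (ε i = -1 → StrictAnti (τ i)) ∧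
          (SeamId.law1 (p i)).map (τ i) = SeamId.law1 (p (σ i))) ∧
        (∀ z z', g z' = d z → ∀ i, z' (σ i) = τ i (z i)) ∧
        ∀ i, (∀ t, p (σ i) (ε i * t) = p i t) →
          (∀ t, τ i t = ε i * t) ∧
          ∀ z ∈ SeamId.commonReg d g, ∀ z', g z' = d z →
            SeamId.sv d z i = SeamId.sv g z' (σ i)) := by
  have h : SeamId.IsChartPair g d := ⟨hg, hd, hM⟩
  have hgS := SeamId.isSeparable_of_ae hgC
  have hdS := SeamId.isSeparable_of_ae hdC
  have M : SeamId.IsMonomialPair p g d := ⟨h, hgS, hdS, hp,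
    fun z hz => h.prod_seamDensity_transition hgS hdS hp hmatch hz,
    fun z hz => h.transD_mul_transD_eq_zero hgS hdS hp hmatch hspec hz⟩
  have hae := h.ae_mem_commonReg hp hmatch
  refine ⟨hae, h.symm.ae_mem_commonReg hp hmatch.symm, fun C hC hpre => ?_, fun hpre => ?_⟩
  · obtain ⟨σ, ε, c, hε, hc, hprod, hdata⟩ := M.exists_perm_sign_const hC hpre
    exact ⟨σ, ε, c, hε, hc, hprod, M.identifiesOn hC hdata⟩
  obtain ⟨σ, ε, c, hε, hc, -, hdata⟩ := M.exists_perm_sign_const subset_rfl hpre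
  have hdense : Dense (SeamId.commonReg d g) := MeasureTheory.Measure.dense_of_ae hae
  choose κ hκ using M.exists_cdf_transition_eq hdense hpre hc hdata
  have hone := fun i => M.const_eq_one hε (hc i) (hκ i)
  have hc1 : c = fun _ => 1 := funext fun i => (hone i).1
  subst hc1
  have hid := M.identifiesOn subset_rfl hdata
  set τ : Fin n → ℝ → ℝ := fun i t =>
    SeamId.transition g d (t • SeamId.axis i) (σ i) with hτ
  have hτcdf : ∀ i t, ProbabilityTheory.cdf (SeamId.law1 (p (σ i))) (τ i t) =
      ε i * ProbabilityTheory.cdf (SeamId.law1 (p i)) t + κ i := fun i t => by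
    simp only [hτ]
    rw [hκ i]
    simp
  have hτz : ∀ z i, SeamId.transition g d z (σ i) = τ i (z i) := fun z i =>
    (hp (σ i)).strictMono_cdf.injective (by rw [hκ i z, hτcdf i, div_one])
  have hsurj : ∀ i, Function.Surjective (τ i) := fun i s => by
    obtain ⟨z, hz⟩ := M.exists_coord_surj (σ i) s
    exact ⟨z i, by rw [← hτz, hz]⟩
  have hcont : ∀ i, Continuous (τ i) := fun i =>
    (EuclideanSpace.proj (𝕜 := ℝ) (σ i)).continuous.comp
      (h.continuous_transition.comp (continuous_id.smul continuous_const))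
  have hup : ∀ i, ε i = 1 → ∀ t, ProbabilityTheory.cdf (SeamId.law1 (p (σ i))) (τ i t) =
      ProbabilityTheory.cdf (SeamId.law1 (p i)) t := fun i hi t => by
    rw [hτcdf, (hone i).2.1 hi, hi, one_mul, add_zero]
  have hdown : ∀ i, ε i = -1 → ∀ t, ProbabilityTheory.cdf (SeamId.law1 (p (σ i))) (τ i t) =
      1 - ProbabilityTheory.cdf (SeamId.law1 (p i)) t := fun i hi t => by
    rw [hτcdf, (hone i).2.2 hi, hi]
    ring
  have hmono : ∀ i, ε i = 1 → StrictMono (τ i) := fun i hi s t hst => by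
    rw [← (hp (σ i)).strictMono_cdf.lt_iff_lt, hup i hi, hup i hi]
    exact (hp i).strictMono_cdf hst
  have hanti : ∀ i, ε i = -1 → StrictAnti (τ i) := fun i hi s t hst => by
    rw [← (hp (σ i)).strictMono_cdf.lt_iff_lt, hdown i hi, hdown i hi]
    exact sub_lt_sub_left ((hp i).strictMono_cdf hst) 1
  refine ⟨σ, ε, τ, hε, hid, fun i => ⟨hcont i, ⟨?_, hsurj i⟩, hmono i, hanti i, ?_⟩, ?_,
    fun i hsym => ?_⟩
  · exact (hε i).elim (fun hi => (hmono i hi).injective) fun hi => (hanti i hi).injective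
  · exact (hε i).elim
      (fun hi => (hp i).map_law1_of_cdf_eq (hp (σ i)) (hsurj i) (hmono i hi) (hcont i).measurable
        (hup i hi))
      fun hi => (hp i).map_law1_of_cdf_eq_one_sub (hp (σ i)) (hsurj i) (hanti i hi)
        (hcont i).measurable (hdown i hi)
  · intro z z' hz i
    rw [h.eq_transition hz, hτz]
  · have hτeq : ∀ t, τ i t = ε i * t := fun t => by
      refine (hp (σ i)).strictMono_cdf.injective ?_
      rcases hε i with hi | hi
      · have hpq : p (σ i) = p i := funext fun t => by simpa [hi] using hsym t
        rw [hup i hi, hi, one_mul, hpq]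
      · rw [hdown i hi, hi, neg_one_mul,
          (hp i).cdf_neg (hp (σ i)) fun t => by simpa [hi] using hsym t]
    refine ⟨hτeq, fun z hz z' hz' => ?_⟩
    have h1 := hid.density_eq z hz z' hz' i
    have h2 : z' (σ i) = ε i * z i := by rw [h.eq_transition hz', hτz, hτeq]
    rw [one_mul, SeamId.seamDensity, SeamId.seamDensity, h2, hsym] at h1
    rw [div_eq_mul_inv, div_eq_mul_inv] at h1
    exact inv_injective (mul_left_cancel₀ ((hp i).pos _).ne' h1)
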